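/- Let $m\ge 1$ be the number of candidates. A vote is a complete (linear) order on the candidates, and a voting rule assigns to every profile of $N$ votes a set of winners. For candidates $x,y$ let $D(x,y)$ be the number of votes preferring $x$ to $y$ minus the number preferring $y$ to $x$. The rules considered are: - maximin: the winners are the candidates $x$ maximizing $\min_{y\ne x}D(x,y)$; - Copeland: the winners are the candidates $x$ maximizing $|\{y\ne x: D(x,y)>0\}|$; - Bucklin: the winners are the candidates minimizing the least $\ell$ such that more than half of the votes rank the candidate within their first $\ell$ positions; - plurality with runoff: two candidates with the highest plurality scores are selected (the plurality score is the number of votes ranking the candidate first), and the winner is the one of the two who wins the pairwise election between them; every candidate who wins for some way of breaking ties is a winner, and for $m=1$ the only candidate wins. A candidate $w$ is an $\varepsilon$-winner of a profile of $N$ votes if $w$ can be made a winner by changing at most $\varepsilon N$ votes. A one-pass algorithm with $s$ bits of memory has as its state a memory content in $\{0,1\}^s$. In each step, depending on the memory content only, it either tosses a fair coin or reads the next vote of the stream, and updates its memory according to the outcome or the vote; when it wants to read and the stream is exhausted, it stops and outputs a candidate determined by the memory content. It may depend on the voting rule and on the parameters $m,n,\varepsilon,\delta,c_1,c_2$ below.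 It solves $(\varepsilon,\delta)$-Winner Determination on a class of streams if on each stream of the class it always stops and outputs, with probability at least $1-\delta$ over its coin tosses, an $\varepsilon$-winner. Theorem. Let $0<c_1\le c_2$ and $\delta_0<1$ be constants, and suppose that the number $N$ of votes in the stream is known in advance to lie in $[c_1n,c_2n]$. For all $m\ge1$, $n\ge2$, $\varepsilon>0$ and $0<\delta\le\delta_0$, each of the maximin, Bucklin and plurality with runoff rules has a one-pass algorithm that solves $(\varepsilon,\delta)$-Winner Determination on all such streams with $$O\left(\frac{m\log^2 m\,\log\frac1\delta}{\varepsilon^2}+\log\log n\right)$$ bits of memory, and the Copeland rule has one with $$O\left(\frac{m\log^4 m\,\log\frac1\delta}{\varepsilon^2}+\log\log n\right)$$ bits of memory. Logarithms are to base $2$, and the constants hidden in $O(\cdot)$ depend only on $c_1$, $c_2$, $\delta_0$. -/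

import Mathlib

/-! ### Votes, profiles and voting rules -/

/-- A vote: a complete order on the candidates `Fin m`, given by its rank bijection.
`v x` is the position of the candidate `x`, position `0` being the most preferred one. -/
abbrev Vote (m : ℕ) : Type := Equiv.Perm (Fin m)

/-- A profile of `N` votes over `m` candidates (also: a stream of `N` votes). -/
abbrev Profile (m N : ℕ) : Type := Fin N → Vote m

/-- A voting rule: for all numbers of candidates and of voters, every profile gets its set
of winners. -/
abbrev VotingRule : Type := ∀ m N : ℕ, Profile m N → Set (Fin m)

/-- The number of voters who prefer `x` to `y`. -/
def prefCount {m N : ℕ} (v : Profile m N) (x y : Fin m) : ℕ :=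
  (Finset.univ.filter fun i : Fin N => v i x < v i y).card

/-- The weight of the edge `(x, y)` in the weighted majority graph. -/
def margin {m N : ℕ} (v : Profile m N) (x y : Fin m) : ℤ :=
  (prefCount v x y : ℤ) - (prefCount v y x : ℤ)

/-- The number of voters who rank `x` within their first `l` positions. -/
def topCount {m N : ℕ} (v : Profile m N) (l : ℕ) (x : Fin m) : ℕ :=
  (Finset.univ.filter fun i : Fin N => (v i x : ℕ) < l).card

/-- The maximin score `min_{y ≠ x} D(x, y)` (the minimum over the empty set is `⊤`). -/
def maximinScore {m N : ℕ} (v : Profile m N) (x : Fin m) : WithTop ℤ :=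
  (Finset.univ.erase x).inf fun y => (margin v x y : WithTop ℤ)

/-- The Copeland score: the number of `y ≠ x` with `D(x, y) > 0`. -/
def copelandScore {m N : ℕ} (v : Profile m N) (x : Fin m) : ℕ :=
  (Finset.univ.filter fun y : Fin m => y ≠ x ∧ 0 < margin v x y).card

/-- The Bucklin score: the least `l` such that more than half of the voters rank `x` within
their first `l` positions. -/
noncomputable def bucklinScore {m N : ℕ} (v : Profile m N) (x : Fin m) : ℕ :=
  sInf {l : ℕ | N < 2 * topCount v l x}

/-- The plurality score: the number of voters who rank `x` first. -/
def pluralityScore {m N : ℕ} (v : Profile m N) (x : Fin m) : ℕ :=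
  topCount v 1 x

/-- Maximin: the candidates with the largest maximin score win. -/
def maximinRule : VotingRule := fun _ _ v =>
  {x | ∀ z, maximinScore v z ≤ maximinScore v x}

/-- Copeland: the candidates with the largest Copeland score win. -/
def copelandRule : VotingRule := fun _ _ v =>
  {x | ∀ z, copelandScore v z ≤ copelandScore v x}

/-- Bucklin: the candidates with the lowest Bucklin score win. -/
def bucklinRule : VotingRule := fun _ _ v =>
  {x | ∀ z, bucklinScore v x ≤ bucklinScore v z}

/-- `x` and `y` are two distinct candidates that can be taken as the top two by plurality
score: nobody else has a larger plurality score than one of them. -/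
def IsTopTwo {m N : ℕ} (v : Profile m N) (x y : Fin m) : Prop :=
  x ≠ y ∧ ∀ z, z ≠ x → z ≠ y →
    pluralityScore v z ≤ pluralityScore v x ∧ pluralityScore v z ≤ pluralityScore v y

/-- Plurality with runoff: `x` wins if it is among the top two by plurality score and does not
lose the pairwise election against the other one. In case of ties every candidate that
wins for some way of breaking the ties is a winner; a candidate without opponents wins. -/
def runoffRule : VotingRule := fun _ _ v =>
  {x | (∀ y, y = x) ∨ ∃ y, IsTopTwo v x y ∧ 0 ≤ margin v x y}

/-- `w` is an `ε`-winner: it can be made a winner by changing at most `ε N` of the `N` votes. -/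
def IsEpsWinner (r : VotingRule) (ε : ℝ) {m N : ℕ} (v : Profile m N) (w : Fin m) : Prop :=
  ∃ v' : Profile m N, (hammingDist v v' : ℝ) ≤ ε * (N : ℝ) ∧ w ∈ r m N v'

/-! ### One-pass algorithms with `s` bits of memory and a fair coin -/

/-- A one-pass algorithm over the universe `U` with outputs in `C`, using `s` bits of memory and
a fair coin as its only source of randomness. At every step it acts on its memory content only:
either it tosses the coin and updates the memory, or it reads the next
item of the stream and updates the memory; when it wants to read and the stream is exhausted, it
stops and answers. Thus also everything it has to remember between two coin tosses
is part of the `s` bits. -/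
structure StreamAlg (U C : Type) (s : ℕ) where
  /-- the initial memory content -/
  init : Fin s → Bool
  /-- whether the algorithm tosses the coin at this memory content (otherwise it reads) -/
  tosses : (Fin s → Bool) → Bool
  /-- the new memory content after a coin toss -/
  onToss : (Fin s → Bool) → Bool → (Fin s → Bool)
  /-- the new memory content after reading an item -/
  onRead : (Fin s → Bool) → U → (Fin s → Bool)
  /-- the answer, once the stream is exhausted -/
  output : (Fin s → Bool) → C

namespace StreamAlg

variable {U C : Type} {s : ℕ}

/-- One step on a pair of a memory content and the unread rest of the stream. A fresh coin `b` is
supplied with every step and ignored if the step is not a coin toss. -/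
def step (A : StreamAlg U C s) (c : (Fin s → Bool) × List U) (b : Bool) :
    (Fin s → Bool) × List U :=
  if A.tosses c.1 then (A.onToss c.1 b, c.2)
  else match c.2 with
    | [] => c
    | u :: rest => (A.onRead c.1 u, rest)

/-- The situation after `T` steps on the stream `xs`, with the coin outcomes `ω`. -/
def exec (A : StreamAlg U C s) (xs : List U) {T : ℕ} (ω : Fin T → Bool) :
    (Fin s → Bool) × List U :=
  (List.ofFn ω).foldl A.step (A.init, xs)

/-- The algorithm has stopped: the stream is exhausted and no coin toss is pending. -/
def Halted (A : StreamAlg U C s) (c : (Fin s → Bool) × List U) : Prop :=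
  A.tosses c.1 = false ∧ c.2 = []

/-- On the stream `xs` the algorithm always stops (within some number `T` of steps, whatever the
coin tosses are), and its answer lies in `good` with probability at least `p`, over its
fair coin tosses. -/
def AnswersWithProb (A : StreamAlg U C s) (xs : List U) (good : Set C) (p : ℝ) : Prop :=
  ∃ T : ℕ, (∀ ω : Fin T → Bool, A.Halted (A.exec xs ω)) ∧
    p ≤ ({ω : Fin T → Bool | A.output (A.exec xs ω).1 ∈ good}.ncard : ℝ) / 2 ^ T

end StreamAlg

/-- `A` solves `(ε, δ)`-winner determination for the rule `r` on `m` candidates on all streams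
whose number `N` of votes lies in `[a, b]`: on each of them it outputs an `ε`-winner with
probability at least `1 - δ`. -/
def SolvesWinnerDetermination (r : VotingRule) {m s : ℕ} (A : StreamAlg (Vote m) (Fin m) s)
    (a b ε δ : ℝ) : Prop :=
  ∀ (N : ℕ), a ≤ (N : ℝ) → (N : ℝ) ≤ b → ∀ v : Profile m N,
    A.AnswersWithProb (List.ofFn v) {w | IsEpsWinner r ε v w} (1 - δ)

/-- If the number of votes is known in advance to lie in `[c₁ n, c₂ n]`, then one-pass
`(ε, δ)`-winner determination for `r` is possible with `O(B m n ε δ)` bits of memory. The constant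
`K` of the `O` is independent of `m`, `n`, `ε`, `δ`; it may depend on `c₁`, `c₂` and on a bound
`δ₀ < 1` for `δ`. -/
def WinnerDeterminationInSpace (r : VotingRule) (c₁ c₂ : ℝ)
    (B : ℕ → ℕ → ℝ → ℝ → ℝ) : Prop :=
  ∀ δ₀ : ℝ, δ₀ < 1 → ∃ K : ℝ, ∀ m n : ℕ, 1 ≤ m → 2 ≤ n →
    ∀ ε δ : ℝ, 0 < ε → 0 < δ → δ ≤ δ₀ →
      ∃ (s : ℕ) (A : StreamAlg (Vote m) (Fin m) s),
        (s : ℝ) ≤ K * B m n ε δ ∧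
        SolvesWinnerDetermination r A (c₁ * n) (c₂ * n) ε δ

/-! The algorithm keeps each vote independently with probability `2⁻ᵏ`, so that about `ℓ = O(log m ·
log(1/δ) / ε²)` votes are stored, and answers from the stored profile `u` alone. Each stored vote
costs `O(m log m)` bits. The only other costs are one flag and a counter of coin tosses up to `k ≤
log n + O(1)`, which takes `log log n + O(1)` bits.

By a Chernoff bound and a union bound over `2 m²` tests, all pairwise and top-`l` frequencies of `u`
are close to those of the stream `v` (`IsClose`) with probability at least `1 - δ`. It remains to
choose from `u` a candidate `w` that is an `ε`-winner of every `v` close to `u`. By the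
probabilistic method (`exists_isSpread`) there is a set `R` of about `ρ N` voters, `ρ = ε / 2`,
whose votes mirror the frequencies of `v` (`IsSpread`). Changing the votes in `R` raises the counts
of `w` by a constant multiple of `ρ N` wherever they are critical, which outweighs the sampling
error. `HasRobustWinners` isolates this deterministic statement. It is proved rule by rule; for
Copeland and Bucklin, `w` is optimal in `u` for a score with a slightly relaxed majority threshold.
-/

namespace StreamAlg

/-! ### Expectations over coin tosses -/

variable {U C : Type} {s : ℕ}

/-- The expectation of `F` after one step from `c`. -/
noncomputable def avg (A : StreamAlg U C s) (F : (Fin s → Bool) × List U → ℝ)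
    (c : (Fin s → Bool) × List U) : ℝ :=
  (F (A.step c true) + F (A.step c false)) / 2

/-- Splitting off the first coin turns the average over all coin sequences into an iteration of the
one-step operator. -/
theorem sum_foldl_eq_avg (A : StreamAlg U C s) (F : (Fin s → Bool) × List U → ℝ) (T : ℕ)
    (c : (Fin s → Bool) × List U) :
    (∑ ω : Fin T → Bool, F ((List.ofFn ω).foldl A.step c)) / 2 ^ T = (A.avg^[T] F) c := by
  induction T generalizing c with
  | zero => simp
  | succ T ih =>
    rw [Function.iterate_succ_apply', avg, ← ih, ← ih]
    rw [← (Fin.consEquiv fun _ : Fin (T + 1) => Bool).sum_comp, Fintype.sum_prod_type]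
    simp only [Fin.consEquiv, Equiv.coe_fn_mk, List.ofFn_succ, Fin.cons_zero, Fin.cons_succ,
      List.foldl_cons, Fintype.sum_bool]
    rw [pow_succ]
    field_simp

theorem ncard_div_eq_avg (A : StreamAlg U C s) (S : Set ((Fin s → Bool) × List U)) (T : ℕ)
    (xs : List U) :
    ({ω : Fin T → Bool | A.exec xs ω ∈ S}.ncard : ℝ) / 2 ^ T
      = (A.avg^[T] (S.indicator 1)) (A.init, xs) := by
  classical
  rw [← sum_foldl_eq_avg]
  congr 1
  have : {ω : Fin T → Bool | A.exec xs ω ∈ S}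
      = ((Finset.univ.filter fun ω : Fin T → Bool => A.exec xs ω ∈ S) : Set (Fin T → Bool)) := by
    ext; simp
  rw [this, Set.ncard_coe_finset, Finset.card_filter]
  push_cast
  refine Finset.sum_congr rfl fun ω _ => ?_
  simp only [Set.indicator_apply, exec, Pi.one_apply]
  congr

/-- A 0/1-valued function has average 1 only if it is 1 everywhere, so certain halting is also a
statement about `avg`. -/
theorem answersWithProb_of_avg (A : StreamAlg U C s) (xs : List U) (good : Set C) (p : ℝ) (T : ℕ)
    (hh : (A.avg^[T] ({c | A.Halted c}.indicator 1)) (A.init, xs) = 1)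
    (hp : p ≤ (A.avg^[T] ({c | A.output c.1 ∈ good}.indicator 1)) (A.init, xs)) :
    A.AnswersWithProb xs good p := by
  refine ⟨T, ?_, ?_⟩
  · rw [← ncard_div_eq_avg, div_eq_one_iff_eq (by positivity)] at hh
    have hu : {ω : Fin T → Bool | A.exec xs ω ∈ {c | A.Halted c}} = Set.univ := by
      rw [Set.eq_univ_iff_ncard]
      have : Nat.card (Fin T → Bool) = 2 ^ T := by simp
      rw [this]
      exact_mod_cast hh
    intro ω
    have : ω ∈ {ω : Fin T → Bool | A.exec xs ω ∈ {c | A.Halted c}} := hu ▸ Set.mem_univ ω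
    exact this
  · rw [← ncard_div_eq_avg] at hp
    exact hp

end StreamAlg

/-! ### Bernoulli sampling -/

/-- The expectation of `G (σ ++ τ)`, where `τ` is the sublist of `xs` that keeps every item
independently with probability `p`. -/
noncomputable def sampleExp {U : Type} (p : ℝ) (G : List U → ℝ) : List U → List U → ℝ
  | σ, [] => G σ
  | σ, u :: xs => p * sampleExp p G (σ ++ [u]) xs + (1 - p) * sampleExp p G σ xs

section sampleExp

variable {U : Type} {p : ℝ}

theorem sampleExp_mono (h0 : 0 ≤ p) (h1 : p ≤ 1) {F G : List U → ℝ} (h : ∀ τ, F τ ≤ G τ)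
    (xs σ : List U) : sampleExp p F σ xs ≤ sampleExp p G σ xs := by
  induction xs generalizing σ with
  | nil => exact h σ
  | cons u xs ih =>
    simp only [sampleExp]
    have := sub_nonneg.2 h1
    gcongr <;> apply ih

theorem sampleExp_const (c : ℝ) (xs σ : List U) : sampleExp p (fun _ => c) σ xs = c := by
  induction xs generalizing σ with
  | nil => rfl
  | cons u xs ih => simp only [sampleExp, ih]; ring

theorem sampleExp_add (F G : List U → ℝ) (xs σ : List U) :
    sampleExp p (fun τ => F τ + G τ) σ xs = sampleExp p F σ xs + sampleExp p G σ xs := by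
  induction xs generalizing σ with
  | nil => rfl
  | cons u xs ih => simp only [sampleExp, ih]; ring

theorem sampleExp_mul_left (c : ℝ) (F : List U → ℝ) (xs σ : List U) :
    sampleExp p (fun τ => c * F τ) σ xs = c * sampleExp p F σ xs := by
  induction xs generalizing σ with
  | nil => rfl
  | cons u xs ih => simp only [sampleExp, ih]; ring

theorem sampleExp_sum {ι : Type*} (s : Finset ι) (F : ι → List U → ℝ) (xs σ : List U) :
    sampleExp p (fun τ => ∑ j ∈ s, F j τ) σ xs = ∑ j ∈ s, sampleExp p (F j) σ xs := by
  classical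
  induction s using Finset.induction_on with
  | empty => simp [sampleExp_const]
  | insert a s ha ih => simp only [Finset.sum_insert ha, sampleExp_add, ih]

theorem sampleExp_one (G : List U → ℝ) (xs σ : List U) :
    sampleExp 1 G σ xs = G (σ ++ xs) := by
  induction xs generalizing σ with
  | nil => simp [sampleExp]
  | cons u xs ih => simp [sampleExp, ih]

/-- The probabilistic method: a positive expectation is witnessed by some sample. -/
theorem exists_sublist_of_sampleExp_pos (h0 : 0 ≤ p) (h1 : p ≤ 1) (G : List U → ℝ)
    (xs σ : List U) (h : 0 < sampleExp p G σ xs) : ∃ τ, τ.Sublist xs ∧ 0 < G (σ ++ τ) := by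
  induction xs generalizing σ with
  | nil => exact ⟨[], List.Sublist.refl _, by simpa [sampleExp] using h⟩
  | cons u xs ih =>
    simp only [sampleExp] at h
    by_cases h2 : 0 < sampleExp p G (σ ++ [u]) xs
    · obtain ⟨τ, hτ, h3⟩ := ih _ h2
      exact ⟨u :: τ, hτ.cons_cons u, by simpa using h3⟩
    · have h3 : 0 < sampleExp p G σ xs := by
        by_contra h4
        push Not at h2 h4
        nlinarith [mul_nonneg h0 (neg_nonneg.2 h2), mul_nonneg (sub_nonneg.2 h1) (neg_nonneg.2 h4)]
      obtain ⟨τ, hτ, h4⟩ := ih _ h3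
      exact ⟨τ, hτ.cons u, h4⟩

/-- Moment generating function: an item satisfying `P` contributes the factor `1 + p (eˡ - 1) ≤ exp
(p (eˡ - 1))`, any other item the factor 1. -/
theorem sampleExp_exp_count_le (h0 : 0 ≤ p) (h1 : p ≤ 1) (P : U → Bool) (l : ℝ)
    (xs σ : List U) :
    sampleExp p (fun τ => Real.exp (l * τ.countP P)) σ xs
      ≤ Real.exp (l * σ.countP P) * Real.exp (p * (Real.exp l - 1) * xs.countP P) := by
  induction xs generalizing σ with
  | nil => simp [sampleExp]
  | cons u xs ih =>
    have h2 := sub_nonneg.2 h1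
    simp only [sampleExp]
    have ha := ih (σ ++ [u])
    have hb := ih σ
    refine (add_le_add (mul_le_mul_of_nonneg_left ha h0)
      (mul_le_mul_of_nonneg_left hb h2)).trans ?_
    by_cases hu : P u
    · simp only [List.countP_append, List.countP_cons, List.countP_nil, hu, if_true]
      push_cast
      have e1 : Real.exp (l * (σ.countP P + 1)) = Real.exp (l * σ.countP P) * Real.exp l := by
        rw [← Real.exp_add]; ring_nf
      have e2 : Real.exp (p * (Real.exp l - 1) * (xs.countP P + 1))
          = Real.exp (p * (Real.exp l - 1) * xs.countP P) * Real.exp (p * (Real.exp l - 1)) := by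
        rw [← Real.exp_add]; ring_nf
      rw [e1, e2]
      have e3 := Real.add_one_le_exp (p * (Real.exp l - 1))
      have e4 : 0 ≤ Real.exp (l * σ.countP P) * Real.exp (p * (Real.exp l - 1) * xs.countP P) := by
        positivity
      nlinarith [mul_le_mul_of_nonneg_left e3 e4]
    · simp only [List.countP_append, List.countP_cons, List.countP_nil, hu]
      apply le_of_eq
      push_cast
      simp
      ring

theorem sampleExp_exp_deviation_le (h0 : 0 ≤ p) (h1 : p ≤ 1) (P : U → Bool) {l : ℝ}
    (hl : |l| ≤ 1) (t : ℝ) (xs : List U) :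
    sampleExp p (fun τ => Real.exp (l * (τ.countP P - p * xs.countP P) - t)) [] xs
      ≤ Real.exp (l ^ 2 * (p * xs.length) - t) := by
  have e : (fun τ : List U => Real.exp (l * (τ.countP P - p * xs.countP P) - t))
      = fun τ => Real.exp (- (l * (p * xs.countP P)) - t) * Real.exp (l * τ.countP P) := by
    funext τ; rw [← Real.exp_add]; ring_nf
  rw [e, sampleExp_mul_left]
  refine (mul_le_mul_of_nonneg_left (sampleExp_exp_count_le h0 h1 P l xs [])
    (Real.exp_pos _).le).trans ?_
  rw [← Real.exp_add, ← Real.exp_add, Real.exp_le_exp]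
  -- `eˡ - 1 - l ≤ l²` for `|l| ≤ 1`; centring cancels the term linear in `l`.
  have h2 := Real.abs_exp_sub_one_sub_id_le hl
  have h3 := (abs_le.1 h2).2
  have h4 : (xs.countP P : ℝ) ≤ xs.length := by exact_mod_cast List.countP_le_length
  simp only [List.countP_nil, Nat.cast_zero, mul_zero, zero_add]
  have h5 : 0 ≤ p * (xs.countP P : ℝ) := by positivity
  nlinarith [mul_le_mul_of_nonneg_right h3 h5, mul_nonneg (mul_nonneg h0 (sq_nonneg l)) (sub_nonneg.2 h4)]

/-- A Chernoff bound, simultaneously for finitely many counts. -/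
theorem sampleExp_deviation_le {ι : Type*} [Fintype ι] (h0 : 0 ≤ p) (h1 : p ≤ 1)
    (P : ι → U → Bool) {η : ℝ} (hη : 0 ≤ η) (hη1 : η ≤ 1) (xs : List U) :
    sampleExp p ({τ | ∃ j, η * (p * xs.length) < |(τ.countP (P j) : ℝ) - p * xs.countP (P j)|}.indicator 1)
        [] xs
      ≤ 2 * Fintype.card ι * Real.exp (-(η ^ 2 * (p * xs.length) / 4)) := by
  -- With `l = ±η/2`, this `t` makes one exponent nonnegative as soon as a deviation exceeds `η p
  -- |xs|`, and `l² p |xs| - t = -η² p |xs| / 4`.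
  set t : ℝ := η ^ 2 * (p * xs.length) / 2 with ht
  have hl : |η / 2| ≤ 1 := by rw [abs_of_nonneg (by linarith)]; linarith
  have hl' : |-(η / 2)| ≤ 1 := by rwa [abs_neg]
  have hb : ∀ τ : List U,
      ({τ | ∃ j, η * (p * xs.length) < |(τ.countP (P j) : ℝ) - p * xs.countP (P j)|}.indicator 1 τ : ℝ)
      ≤ ∑ j : ι, (Real.exp (η / 2 * (τ.countP (P j) - p * xs.countP (P j)) - t)
          + Real.exp (-(η / 2) * (τ.countP (P j) - p * xs.countP (P j)) - t)) := by
    intro τ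
    by_cases h : ∃ j, η * (p * xs.length) < |(τ.countP (P j) : ℝ) - p * xs.countP (P j)|
    · rw [Set.indicator_of_mem (by exact h)]
      obtain ⟨j, hj⟩ := h
      refine le_trans ?_ (Finset.single_le_sum (f := fun j : ι =>
        Real.exp (η / 2 * ((τ.countP (P j) : ℝ) - p * xs.countP (P j)) - t)
          + Real.exp (-(η / 2) * ((τ.countP (P j) : ℝ) - p * xs.countP (P j)) - t))
        (fun _ _ => by positivity) (Finset.mem_univ j))
      simp only [Pi.one_apply]
      rcases lt_abs.1 hj with h | h
      · have : 1 ≤ Real.exp (η / 2 * ((τ.countP (P j) : ℝ) - p * xs.countP (P j)) - t) := by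
          apply Real.one_le_exp; rw [ht]; nlinarith
        have := Real.exp_pos (-(η / 2) * ((τ.countP (P j) : ℝ) - p * xs.countP (P j)) - t)
        linarith
      · have : 1 ≤ Real.exp (-(η / 2) * ((τ.countP (P j) : ℝ) - p * xs.countP (P j)) - t) := by
          apply Real.one_le_exp; rw [ht]; nlinarith
        have := Real.exp_pos (η / 2 * ((τ.countP (P j) : ℝ) - p * xs.countP (P j)) - t)
        linarith
    · rw [Set.indicator_of_notMem (by exact h)]
      positivity
  refine (sampleExp_mono h0 h1 hb xs []).trans ?_
  rw [sampleExp_sum]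
  have hj : ∀ j ∈ (Finset.univ : Finset ι), sampleExp p (fun τ =>
      Real.exp (η / 2 * ((τ.countP (P j) : ℝ) - p * xs.countP (P j)) - t)
        + Real.exp (-(η / 2) * ((τ.countP (P j) : ℝ) - p * xs.countP (P j)) - t)) [] xs
      ≤ 2 * Real.exp (-(η ^ 2 * (p * xs.length) / 4)) := by
    intro j _
    rw [sampleExp_add]
    have a := sampleExp_exp_deviation_le h0 h1 (P j) hl t xs
    have b := sampleExp_exp_deviation_le h0 h1 (P j) hl' t xs
    have e1 : (η / 2) ^ 2 * (p * xs.length) - t = -(η ^ 2 * (p * xs.length) / 4) := by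
      rw [ht]; ring
    have e2 : (-(η / 2)) ^ 2 * (p * xs.length) - t = -(η ^ 2 * (p * xs.length) / 4) := by
      rw [ht]; ring
    rw [e1] at a
    rw [e2] at b
    linarith
  refine (Finset.sum_le_sum hj).trans (le_of_eq ?_)
  rw [Finset.sum_const, Finset.card_univ, nsmul_eq_mul]
  ring

end sampleExp

/-! ### The sampling algorithm and its memory -/

namespace StreamAlg

variable {U C : Type} {s k L : ℕ}

/-- The algorithm that keeps every item with probability `2⁻ᵏ`, stores at most `L` items and
answers according to the stored items. Its memory encodes the number of coins tossed since the
last item was read, whether all of them were heads, and the stored items. -/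
noncomputable def sampler (k L : ℕ) (enc : ℕ × Bool × List U → Fin s → Bool)
    (dec : (Fin s → Bool) → ℕ × Bool × List U) (out : List U → C) : StreamAlg U C s where
  init := enc (0, true, [])
  tosses a := decide ((dec a).1 < k)
  onToss a b := enc ((dec a).1 + 1, (dec a).2.1 && b, (dec a).2.2)
  onRead a u := enc (0, true, if (dec a).2.1 then ((dec a).2.2 ++ [u]).take L else (dec a).2.2)
  output a := out (dec a).2.2

variable {enc : ℕ × Bool × List U → Fin s → Bool} {dec : (Fin s → Bool) → ℕ × Bool × List U}
  {out : List U → C}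

theorem sampler_step_toss
    (hd : ∀ c fl σ, c ≤ k → σ.length ≤ L → dec (enc (c, fl, σ)) = (c, fl, σ))
    {c : ℕ} (hc : c < k) (fl : Bool) {σ : List U} (hσ : σ.length ≤ L) (xs : List U) (b : Bool) :
    (sampler k L enc dec out).step (enc (c, fl, σ), xs) b = (enc (c + 1, fl && b, σ), xs) := by
  simp [step, sampler, hd c fl σ hc.le hσ, hc]

theorem sampler_step_read
    (hd : ∀ c fl σ, c ≤ k → σ.length ≤ L → dec (enc (c, fl, σ)) = (c, fl, σ))
    (fl : Bool) {σ : List U} (hσ : σ.length ≤ L) (u : U) (xs : List U) (b : Bool) :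
    (sampler k L enc dec out).step (enc (k, fl, σ), u :: xs) b
      = (enc (0, true, if fl then (σ ++ [u]).take L else σ), xs) := by
  simp [step, sampler, hd k fl σ le_rfl hσ]

theorem sampler_avg_toss_false
    (hd : ∀ c fl σ, c ≤ k → σ.length ≤ L → dec (enc (c, fl, σ)) = (c, fl, σ))
    {σ : List U} (hσ : σ.length ≤ L) (xs : List U) (F : (Fin s → Bool) × List U → ℝ)
    (j c : ℕ) (h : c + j = k) :
    ((sampler k L enc dec out).avg^[j] F) (enc (c, false, σ), xs) = F (enc (k, false, σ), xs) := by
  induction j generalizing c with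
  | zero => simp only [Function.iterate_zero, id]; rw [← h]; rfl
  | succ j ih =>
    rw [Function.iterate_succ_apply', avg, sampler_step_toss hd (by omega) _ hσ,
      sampler_step_toss hd (by omega) _ hσ]
    simp only [Bool.false_and]
    rw [ih (c + 1) (by omega)]
    ring

theorem sampler_avg_toss
    (hd : ∀ c fl σ, c ≤ k → σ.length ≤ L → dec (enc (c, fl, σ)) = (c, fl, σ))
    {σ : List U} (hσ : σ.length ≤ L) (xs : List U) (F : (Fin s → Bool) × List U → ℝ)
    (j c : ℕ) (h : c + j = k) :
    ((sampler k L enc dec out).avg^[j] F) (enc (c, true, σ), xs)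
      = (1 / 2) ^ j * F (enc (k, true, σ), xs)
        + (1 - (1 / 2) ^ j) * F (enc (k, false, σ), xs) := by
  induction j generalizing c with
  | zero => simp only [Function.iterate_zero, id]; rw [← h]; simp
  | succ j ih =>
    rw [Function.iterate_succ_apply', avg, sampler_step_toss hd (by omega) _ hσ,
      sampler_step_toss hd (by omega) _ hσ]
    simp only [Bool.true_and]
    rw [ih (c + 1) (by omega), sampler_avg_toss_false hd hσ _ _ _ _ (by omega)]
    ring

/-- Each item takes `k` tosses and one read; `k` more tosses follow before the end of the stream is
noticed, and `hF` makes their outcome irrelevant. The memory holds the truncation of an untruncated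
Bernoulli sample, so the sample can be analysed without the bound `L`. -/
theorem sampler_avg_eq_sampleExp
    (hd : ∀ c fl σ, c ≤ k → σ.length ≤ L → dec (enc (c, fl, σ)) = (c, fl, σ))
    (F : (Fin s → Bool) × List U → ℝ) (G : List U → ℝ)
    (hF : ∀ fl τ, F (enc (k, fl, τ.take L), []) = G τ) (xs σ : List U) :
    ((sampler k L enc dec out).avg^[xs.length * (k + 1) + k] F) (enc (0, true, σ.take L), xs)
      = sampleExp ((1 / 2) ^ k) G σ xs := by
  have hl : ∀ τ : List U, (τ.take L).length ≤ L := fun τ => by simp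
  induction xs generalizing σ with
  | nil =>
    simp only [List.length_nil, zero_mul, zero_add]
    rw [sampler_avg_toss hd (hl σ) _ _ _ _ (by omega), hF, hF, sampleExp]
    ring
  | cons u xs ih =>
    have e : (u :: xs).length * (k + 1) + k = k + ((xs.length * (k + 1) + k) + 1) := by
      simp only [List.length_cons]; ring
    rw [e, Function.iterate_add_apply, sampler_avg_toss hd (hl σ) _ _ _ _ (by omega),
      Function.iterate_succ_apply', avg, avg, sampler_step_read hd _ (hl σ),
      sampler_step_read hd _ (hl σ), sampler_step_read hd _ (hl σ),
      sampler_step_read hd _ (hl σ)]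
    -- Truncating after every read is the same as truncating once at the end.
    have e2 : (σ.take L ++ [u]).take L = (σ ++ [u]).take L := by
      simp only [List.take_append, List.take_take, min_self, List.length_take]
      congr 2
      omega
    simp only [if_true, e2, Bool.false_eq_true, if_false]
    rw [ih, ih, sampleExp]
    ring

theorem sampler_answersWithProb
    (hd : ∀ c fl σ, c ≤ k → σ.length ≤ L → dec (enc (c, fl, σ)) = (c, fl, σ))
    (xs : List U) (good : Set C) (p : ℝ)
    (hp : p ≤ sampleExp ((1 / 2) ^ k) ({τ | out (τ.take L) ∈ good}.indicator 1) [] xs) :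
    (sampler k L enc dec out).AnswersWithProb xs good p := by
  have hl : ∀ τ : List U, (τ.take L).length ≤ L := fun τ => by simp
  have hi : (sampler k L enc dec out).init = enc (0, true, ([] : List U).take L) := by
    simp [sampler]
  apply answersWithProb_of_avg _ _ _ _ (xs.length * (k + 1) + k)
  · rw [hi, sampler_avg_eq_sampleExp hd _ (fun _ => 1), sampleExp_const]
    intro fl τ
    rw [Set.indicator_of_mem, Pi.one_apply]
    simp [Halted, sampler, hd k fl _ le_rfl (hl τ)]
  · rw [hi, sampler_avg_eq_sampleExp hd _ ({τ | out (τ.take L) ∈ good}.indicator 1)]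
    · exact hp
    intro fl τ
    have e : (sampler k L enc dec out).output (enc (k, fl, τ.take L)) = out (τ.take L) := by
      simp [sampler, hd k fl _ le_rfl (hl τ)]
    by_cases h : out (τ.take L) ∈ good
    · rw [Set.indicator_of_mem, Set.indicator_of_mem] <;> simp [e, h]
    · rw [Set.indicator_of_notMem, Set.indicator_of_notMem] <;> simp [e, h]

/-- The memory contents of the sampler fit into `s` bits. -/
theorem exists_encoding [Fintype U] {s : ℕ} (k L : ℕ)
    (h : 2 * (k + 1) * (Fintype.card U + 1) ^ L ≤ 2 ^ s) :
    ∃ (enc : ℕ × Bool × List U → Fin s → Bool) (dec : (Fin s → Bool) → ℕ × Bool × List U),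
      ∀ c fl σ, c ≤ k → σ.length ≤ L → dec (enc (c, fl, σ)) = (c, fl, σ) := by
  classical
  let D := Fin (k + 1) × Bool × (Fin L → Option U)
  have hcard : Fintype.card D ≤ Fintype.card (Fin s → Bool) := by
    simp only [D, Fintype.card_prod, Fintype.card_fin, Fintype.card_bool, Fintype.card_fun,
      Fintype.card_option]
    calc _ = 2 * (k + 1) * (Fintype.card U + 1) ^ L := by ring
      _ ≤ _ := h
  obtain ⟨f⟩ := Function.Embedding.nonempty_of_card_le hcard
  -- A list of length at most `L` is padded with `none` to `L` slots; `g` is injective on such lists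
  -- with `c ≤ k`.
  let g : ℕ × Bool × List U → D := fun x => (Fin.ofNat (k + 1) x.1, x.2.1, fun i => x.2.2[(i : ℕ)]?)
  have hg : Set.InjOn (f ∘ g) {x | x.1 ≤ k ∧ x.2.2.length ≤ L} := by
    rintro ⟨c, fl, σ⟩ ⟨h1, h2⟩ ⟨c', fl', σ'⟩ ⟨h3, h4⟩ h
    have h5 : g (c, fl, σ) = g (c', fl', σ') := f.injective h
    have ha : Fin.ofNat (k + 1) c = Fin.ofNat (k + 1) c' := congrArg Prod.fst h5
    have hb : fl = fl' := congrArg (fun x => x.2.1) h5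
    have hc : (fun i : Fin L => σ[(i : ℕ)]?) = fun i : Fin L => σ'[(i : ℕ)]? :=
      congrArg (fun x => x.2.2) h5
    simp only at h1 h2 h3 h4
    refine Prod.ext ?_ (Prod.ext hb ?_)
    · have := congrArg Fin.val ha
      simpa [Fin.ofNat, Nat.mod_eq_of_lt (Nat.lt_succ_of_le h1),
        Nat.mod_eq_of_lt (Nat.lt_succ_of_le h3)] using this
    · apply List.ext_getElem?
      intro i
      by_cases hi : i < L
      · exact congrFun hc ⟨i, hi⟩
      · rw [List.getElem?_eq_none (h2.trans (not_lt.1 hi)),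
          List.getElem?_eq_none (h4.trans (not_lt.1 hi))]
  have : Nonempty (ℕ × Bool × List U) := ⟨(0, true, [])⟩
  refine ⟨f ∘ g, Function.invFunOn (f ∘ g) {x | x.1 ≤ k ∧ x.2.2.length ≤ L}, ?_⟩
  intro c fl σ h1 h2
  exact hg.leftInvOn_invFunOn (x := (c, fl, σ)) ⟨h1, h2⟩

end StreamAlg

/-! ### Counts in a profile -/

section Profile

variable {m N : ℕ}

theorem prefCount_add_prefCount (v : Profile m N) {x y : Fin m} (h : x ≠ y) :
    prefCount v x y + prefCount v y x = N := by
  have := Finset.card_filter_add_card_filter_not (s := (Finset.univ : Finset (Fin N)))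
    (fun i => v i x < v i y)
  rw [Finset.card_univ, Fintype.card_fin] at this
  rw [prefCount, prefCount]
  convert this using 3
  ext i
  have : v i x ≠ v i y := fun h' => h ((v i).injective h')
  simp only [Finset.mem_filter, Finset.mem_univ, true_and]
  omega

theorem margin_eq (v : Profile m N) {x y : Fin m} (h : x ≠ y) :
    margin v x y = 2 * (prefCount v x y : ℤ) - N := by
  have := prefCount_add_prefCount v h
  rw [margin]; omega

theorem margin_comm (v : Profile m N) (x y : Fin m) : margin v y x = -margin v x y := by
  rw [margin, margin]; omega

theorem topCount_le (v : Profile m N) (l : ℕ) (x : Fin m) : topCount v l x ≤ N := by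
  refine (Finset.card_le_univ _).trans ?_
  simp

theorem prefCount_le (v : Profile m N) (x y : Fin m) : prefCount v x y ≤ N := by
  refine (Finset.card_le_univ _).trans ?_
  simp

theorem topCount_of_le (v : Profile m N) {l : ℕ} (h : m ≤ l) (x : Fin m) : topCount v l x = N := by
  rw [topCount, Finset.filter_true_of_mem, Finset.card_univ, Fintype.card_fin]
  intro i _
  exact (v i x).2.trans_le h

theorem topCount_zero (v : Profile m N) (x : Fin m) : topCount v 0 x = 0 := by
  simp [topCount]

theorem isTopTwo_symm {v : Profile m N} {x y : Fin m} (h : IsTopTwo v x y) : IsTopTwo v y x :=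
  ⟨h.1.symm, fun z hy hx => (h.2 z hx hy).symm⟩

/-! ### Moving a candidate to the top -/

/-- The vote obtained from `u` by moving the candidate `w` to the top. -/
def moveTop (w : Fin m) (u : Vote m) : Vote m := u.trans (u w).cycleRange

theorem moveTop_self (w : Fin m) (u : Vote m) : (moveTop w u w : ℕ) = 0 := by
  rw [moveTop, Equiv.trans_apply, Fin.coe_cycleRange_of_le le_rfl]
  simp

theorem moveTop_of_ne {w x : Fin m} (h : x ≠ w) (u : Vote m) :
    (moveTop w u x : ℕ) = if u x < u w then (u x : ℕ) + 1 else u x := by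
  have hne : u x ≠ u w := fun h' => h (u.injective h')
  rw [moveTop, Equiv.trans_apply]
  split_ifs with h1
  · rw [Fin.coe_cycleRange_of_lt h1]
  · rw [Fin.cycleRange_of_gt (lt_of_le_of_ne (not_lt.1 h1) hne.symm)]

theorem le_moveTop {w x : Fin m} (h : x ≠ w) (u : Vote m) : (u x : ℕ) ≤ moveTop w u x := by
  rw [moveTop_of_ne h]; split_ifs <;> omega

theorem moveTop_pos {w x : Fin m} (h : x ≠ w) (u : Vote m) : 0 < (moveTop w u x : ℕ) := by
  have hne : u x ≠ u w := fun h' => h (u.injective h')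
  rw [moveTop_of_ne h]; split_ifs <;> omega

theorem moveTop_lt_moveTop_iff {w x y : Fin m} (hx : x ≠ w) (hy : y ≠ w) (u : Vote m) :
    moveTop w u x < moveTop w u y ↔ u x < u y := by
  have h1 : u x ≠ u w := fun h' => hx (u.injective h')
  have h2 : u y ≠ u w := fun h' => hy (u.injective h')
  rw [Fin.lt_def, moveTop_of_ne hx, moveTop_of_ne hy]
  split_ifs <;> omega

/-- Move `w` to the top of the votes in `R`. -/
def liftOn (R : Finset (Fin N)) (w : Fin m) (v : Profile m N) : Profile m N :=
  fun i => if i ∈ R then moveTop w (v i) else v i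

theorem hammingDist_le_card {v v' : Profile m N} {R : Finset (Fin N)}
    (h : ∀ i, i ∉ R → v' i = v i) : hammingDist v v' ≤ R.card := by
  refine Finset.card_le_card fun i hi => ?_
  by_contra h'
  exact (Finset.mem_filter.1 hi).2 (h i h').symm

theorem prefCount_liftOn_self (R : Finset (Fin N)) {w y : Fin m} (h : y ≠ w) (v : Profile m N) :
    prefCount (liftOn R w v) w y
      = prefCount v w y + (R.filter fun i => v i y < v i w).card := by
  rw [prefCount, prefCount, ← Finset.card_union_of_disjoint]
  · congr 1
    ext i
    have hne : v i y ≠ v i w := fun h' => h ((v i).injective h')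
    have h0 := moveTop_self w (v i)
    have h1 := moveTop_pos h (v i)
    simp only [Finset.mem_filter, Finset.mem_univ, true_and, Finset.mem_union]
    simp only [liftOn]
    by_cases hi : i ∈ R
    · simp only [hi, if_true, true_and]; omega
    · simp [hi]
  · rw [Finset.disjoint_left]
    intro i hi hj
    simp only [Finset.mem_filter] at hi hj
    omega

theorem prefCount_liftOn_le (R : Finset (Fin N)) {w z : Fin m} (h : z ≠ w) (y : Fin m)
    (v : Profile m N) : prefCount (liftOn R w v) z y ≤ prefCount v z y := by
  refine Finset.card_le_card fun i hi => ?_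
  simp only [Finset.mem_filter, Finset.mem_univ, true_and] at hi ⊢
  simp only [liftOn] at hi
  split_ifs at hi with hR
  · by_cases hy : y = w
    · subst hy
      have := moveTop_self y (v i)
      omega
    · exact (moveTop_lt_moveTop_iff h hy _).1 hi
  · exact hi

theorem topCount_liftOn_self (R : Finset (Fin N)) (w : Fin m) (v : Profile m N) {l : ℕ}
    (hl : 0 < l) :
    topCount (liftOn R w v) l w
      = topCount v l w + (R.card - (R.filter fun i => (v i w : ℕ) < l).card) := by
  have e : R.card - (R.filter fun i => (v i w : ℕ) < l).card
      = (R.filter fun i => ¬ (v i w : ℕ) < l).card := by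
    have := Finset.card_filter_add_card_filter_not (s := R) (fun i => (v i w : ℕ) < l)
    omega
  rw [e, topCount, topCount, ← Finset.card_union_of_disjoint]
  · congr 1
    ext i
    have h0 := moveTop_self w (v i)
    simp only [Finset.mem_filter, Finset.mem_univ, true_and, Finset.mem_union]
    simp only [liftOn]
    by_cases hi : i ∈ R
    · simp only [hi, if_true, true_and]; omega
    · simp [hi]
  · rw [Finset.disjoint_left]
    intro i hi hj
    simp only [Finset.mem_filter] at hi hj
    omega

theorem topCount_liftOn_le (R : Finset (Fin N)) {w z : Fin m} (h : z ≠ w) (v : Profile m N)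
    (l : ℕ) : topCount (liftOn R w v) l z ≤ topCount v l z := by
  refine Finset.card_le_card fun i hi => ?_
  simp only [Finset.mem_filter, Finset.mem_univ, true_and] at hi ⊢
  simp only [liftOn] at hi
  split_ifs at hi with hR
  · exact (le_moveTop h _).trans_lt hi
  · exact hi

/-! ### Existence of winners -/

theorem maximinRule_nonempty (hm : 0 < m) (v : Profile m N) : (maximinRule m N v).Nonempty := by
  have : Nonempty (Fin m) := ⟨⟨0, hm⟩⟩
  exact Finite.exists_max (maximinScore v)

theorem copelandRule_nonempty (hm : 0 < m) (v : Profile m N) : (copelandRule m N v).Nonempty := by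
  have : Nonempty (Fin m) := ⟨⟨0, hm⟩⟩
  exact Finite.exists_max (copelandScore v)

theorem bucklinRule_nonempty (hm : 0 < m) (v : Profile m N) : (bucklinRule m N v).Nonempty := by
  have : Nonempty (Fin m) := ⟨⟨0, hm⟩⟩
  exact Finite.exists_min (bucklinScore v)

theorem exists_isTopTwo_margin (hm : 2 ≤ m) (v : Profile m N) :
    ∃ x y, IsTopTwo v x y ∧ 0 ≤ margin v x y := by
  have h1 : Nonempty (Fin m) := ⟨⟨0, by omega⟩⟩
  obtain ⟨x, hx⟩ := Finite.exists_max (pluralityScore v)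
  have h2 : (Finset.univ.erase x).Nonempty := by
    rw [← Finset.card_pos, Finset.card_erase_of_mem (Finset.mem_univ x), Finset.card_univ,
      Fintype.card_fin]
    omega
  obtain ⟨y, hy, hy'⟩ := Finset.exists_max_image _ (pluralityScore v) h2
  have ht : IsTopTwo v x y := ⟨(Finset.ne_of_mem_erase hy).symm, fun z hzx _ =>
    ⟨hx z, hy' z (Finset.mem_erase.2 ⟨hzx, Finset.mem_univ z⟩)⟩⟩
  rcases le_total 0 (margin v x y) with h | h
  · exact ⟨x, y, ht, h⟩
  · refine ⟨y, x, isTopTwo_symm ht, ?_⟩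
    rw [margin_comm]; omega

theorem runoffRule_nonempty (hm : 0 < m) (v : Profile m N) : (runoffRule m N v).Nonempty := by
  rcases (show m = 1 ∨ 2 ≤ m by omega) with rfl | h
  · exact ⟨0, Or.inl fun y => Subsingleton.elim _ _⟩
  · obtain ⟨x, y, h1, h2⟩ := exists_isTopTwo_margin h v
    exact ⟨x, Or.inr ⟨y, h1, h2⟩⟩

/-! ### Unanimous profiles -/

/-- All votes rank `w` first. -/
def unanimous (N : ℕ) (w : Fin m) : Profile m N := fun _ => moveTop w (Equiv.refl _)

theorem prefCount_unanimous {w y : Fin m} (h : y ≠ w) :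
    prefCount (unanimous N w) w y = N := by
  rw [prefCount, Finset.filter_true_of_mem, Finset.card_univ, Fintype.card_fin]
  intro i _
  have h0 := moveTop_self w (Equiv.refl _)
  have h1 := moveTop_pos h (Equiv.refl _)
  rw [unanimous]; omega

theorem topCount_unanimous (w : Fin m) {l : ℕ} (hl : 0 < l) :
    topCount (unanimous N w) l w = N := by
  rw [topCount, Finset.filter_true_of_mem, Finset.card_univ, Fintype.card_fin]
  intro i _
  have h0 := moveTop_self w (Equiv.refl _)
  rw [unanimous]; omega

theorem topCount_one_unanimous {w z : Fin m} (h : z ≠ w) :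
    topCount (unanimous N w) 1 z = 0 := by
  rw [topCount, Finset.card_eq_zero, Finset.filter_eq_empty_iff]
  intro i _
  have h1 := moveTop_pos h (Equiv.refl _)
  rw [unanimous]; omega

/-- For `ε ≥ 1` all votes may be changed; this and its analogues make every candidate an `ε`-winner
then. -/
theorem mem_maximinRule_unanimous (w : Fin m) : w ∈ maximinRule m N (unanimous N w) := by
  intro z
  rcases eq_or_ne z w with rfl | hz
  · exact le_rfl
  refine Finset.le_inf fun y hy => ?_
  have hy := Finset.ne_of_mem_erase hy
  refine (Finset.inf_le (Finset.mem_erase.2 ⟨hz.symm, Finset.mem_univ w⟩)).trans ?_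
  rw [WithTop.coe_le_coe, margin_comm, margin_eq _ hz.symm, margin_eq _ hy.symm,
    prefCount_unanimous hz, prefCount_unanimous hy]
  omega

theorem copelandScore_le (v : Profile m N) (z : Fin m) : copelandScore v z ≤ m - 1 := by
  calc copelandScore v z ≤ (Finset.univ.erase z).card :=
        Finset.card_le_card fun y hy =>
          Finset.mem_erase.2 ⟨(Finset.mem_filter.1 hy).2.1, Finset.mem_univ y⟩
    _ = m - 1 := by simp

theorem mem_copelandRule_unanimous (w : Fin m) : w ∈ copelandRule m N (unanimous N w) := by
  intro z
  rcases Nat.eq_zero_or_pos N with rfl | hN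
  · have : copelandScore (unanimous 0 w) z = 0 := by
      rw [copelandScore, Finset.card_eq_zero, Finset.filter_eq_empty_iff]
      rintro y - ⟨_, h⟩
      simp [margin, prefCount] at h
    omega
  · refine (copelandScore_le _ z).trans ?_
    have : copelandScore (unanimous N w) w = (Finset.univ.erase w).card := by
      rw [copelandScore]
      congr 1
      ext y
      simp only [Finset.mem_filter, Finset.mem_univ, true_and, Finset.mem_erase, and_true,
        and_iff_left_iff_imp]
      intro hy
      rw [margin_eq _ hy.symm, prefCount_unanimous hy]
      omega
    rw [this]; simp

theorem bucklinScore_mem (v : Profile m N) (hN : 0 < N) (z : Fin m) :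
    N < 2 * topCount v (bucklinScore v z) z := by
  refine Nat.sInf_mem (s := {l : ℕ | N < 2 * topCount v l z}) ⟨m, ?_⟩
  rw [Set.mem_ofPred_eq, topCount_of_le v le_rfl]
  omega

theorem mem_bucklinRule_unanimous (w : Fin m) : w ∈ bucklinRule m N (unanimous N w) := by
  intro z
  rcases Nat.eq_zero_or_pos N with rfl | hN
  · have : bucklinScore (unanimous 0 w) w = 0 := by
      simp [bucklinScore, topCount]
    omega
  · have h1 : bucklinScore (unanimous N w) w ≤ 1 := by
      refine Nat.sInf_le ?_
      rw [Set.mem_ofPred_eq, topCount_unanimous w one_pos]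
      omega
    have h2 := bucklinScore_mem (unanimous N w) hN z
    by_contra! h3
    rw [show bucklinScore (unanimous N w) z = 0 by omega, topCount_zero] at h2
    omega

theorem mem_runoffRule_unanimous (w : Fin m) : w ∈ runoffRule m N (unanimous N w) := by
  by_cases h : ∀ y, y = w
  · exact Or.inl h
  · push Not at h
    obtain ⟨y, hy⟩ := h
    refine Or.inr ⟨y, ⟨hy.symm, fun z hz _ => ?_⟩, ?_⟩
    · rw [pluralityScore, topCount_one_unanimous hz]
      exact ⟨Nat.zero_le _, Nat.zero_le _⟩
    · rw [margin_eq _ hy.symm, prefCount_unanimous hy]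
      omega

end Profile

/-! ### Winners that can be found from approximate counts -/

/-- The relative frequencies of pairwise preferences and of top positions in the profiles `v` and
`u` differ by at most `η`. -/
structure IsClose (η : ℝ) {m N q : ℕ} (v : Profile m N) (u : Profile m q) : Prop where
  pref : ∀ x y, |(prefCount u x y : ℝ) * N - prefCount v x y * q| ≤ η * N * q
  top : ∀ l x, |(topCount u l x : ℝ) * N - topCount v l x * q| ≤ η * N * q

/-- The set `R` of votes contains about a fraction `ρ` of the votes with any pairwise preference,
and with any candidate among the first `l`. -/
structure IsSpread (ρ η : ℝ) {m N : ℕ} (v : Profile m N) (R : Finset (Fin N)) : Prop where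
  card : |(R.card : ℝ) - ρ * N| ≤ η * (ρ * N)
  pref : ∀ x y, |((R.filter fun i => v i x < v i y).card : ℝ) - ρ * prefCount v x y|
    ≤ η * (ρ * N)
  top : ∀ l x, |((R.filter fun i => (v i x : ℕ) < l).card : ℝ) - ρ * topCount v l x|
    ≤ η * (ρ * N)

/-- Every profile `u` determines a candidate who can be made a winner of every profile close
to `u` by changing the votes of a spread set. -/
def HasRobustWinners (r : VotingRule) : Prop :=
  ∀ (m q : ℕ) (u : Profile m q) (ρ : ℝ), 2 ≤ m → 0 < q → 0 < ρ → ρ ≤ 1 →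
    ∃ w : Fin m, ∀ (N : ℕ) (v : Profile m N), 16 ≤ ρ * N → IsClose (ρ / 16) v u →
      ∀ R, IsSpread ρ (1 / 16) v R →
        ∃ v' : Profile m N, (∀ i, i ∉ R → v' i = v i) ∧ w ∈ r m N v'

section Robust

variable {m N q : ℕ} {v : Profile m N} {u : Profile m q} {ρ : ℝ} {R : Finset (Fin N)}

theorem liftOn_of_notMem (w : Fin m) (v : Profile m N) (i : Fin N) (h : i ∉ R) :
    liftOn R w v i = v i := by simp [liftOn, h]

/-- At least half of all voters prefer `y`, so `R` contains at least `(1/2 - 1/16) ρ N` of them, and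
each now prefers `w`. -/
theorem prefCount_add_le_prefCount_liftOn (h : IsSpread ρ (1 / 16) v R) (hρ : 0 ≤ ρ) {w y : Fin m}
    (hy : y ≠ w) (hN : 2 * prefCount v w y ≤ N) :
    2 * (prefCount v w y : ℝ) + 7 / 8 * (ρ * N) ≤ 2 * prefCount (liftOn R w v) w y := by
  rw [prefCount_liftOn_self R hy]
  push_cast
  have h1 := (abs_le.1 (h.pref y w)).1
  have h2 : (N : ℝ) ≤ 2 * prefCount v y w := by
    have := prefCount_add_prefCount v hy
    exact_mod_cast (show N ≤ 2 * prefCount v y w by omega)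
  nlinarith [mul_le_mul_of_nonneg_left h2 hρ]

/-- `R` has at least `15/16 ρ N` votes, of which at most `(1/2 + 1/16) ρ N` already had `w` among
the first `l`; the other `3/8 ρ N` or more are gained. -/
theorem topCount_add_le_topCount_liftOn (h : IsSpread ρ (1 / 16) v R) (hρ : 0 ≤ ρ) {w : Fin m}
    {l : ℕ} (hl : 0 < l) (hN : 2 * topCount v l w ≤ N) :
    2 * (topCount v l w : ℝ) + 3 / 4 * (ρ * N) ≤ 2 * topCount (liftOn R w v) l w := by
  rw [topCount_liftOn_self R w v hl]
  rw [Nat.cast_add, Nat.cast_sub (Finset.card_filter_le _ _)]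
  have h1 := (abs_le.1 h.card).1
  have h3 := (abs_le.1 (h.top l w)).2
  have h2 : 2 * (topCount v l w : ℝ) ≤ N := by exact_mod_cast hN
  nlinarith [mul_le_mul_of_nonneg_left h2 hρ]

theorem prefCount_le_liftOn_self {w y : Fin m} (hy : y ≠ w) :
    prefCount v w y ≤ prefCount (liftOn R w v) w y := by
  rw [prefCount_liftOn_self R hy]; omega

theorem le_maximinScore_iff (v : Profile m N) (x : Fin m) (a : WithTop ℤ) :
    a ≤ maximinScore v x ↔ ∀ y, y ≠ x → a ≤ (margin v x y : WithTop ℤ) := by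
  simp [maximinScore, Finset.le_inf_iff]

theorem maximinScore_le (v : Profile m N) {x y : Fin m} (h : y ≠ x) :
    maximinScore v x ≤ (margin v x y : WithTop ℤ) :=
  Finset.inf_le (Finset.mem_erase.2 ⟨h, Finset.mem_univ y⟩)

theorem exists_maximinScore_eq (v : Profile m N) {x w : Fin m} (h : w ≠ x) :
    ∃ y, y ≠ x ∧ maximinScore v x = (margin v x y : WithTop ℤ) := by
  obtain ⟨y, hy, h2⟩ := Finset.exists_mem_eq_inf _
    (⟨w, Finset.mem_erase.2 ⟨h, Finset.mem_univ w⟩⟩ : (Finset.univ.erase x).Nonempty)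
    fun y => (margin v x y : WithTop ℤ)
  exact ⟨y, Finset.ne_of_mem_erase hy, h2⟩

/-- Comparing counts in `u` gives an approximate comparison in `v`. -/
theorem le_of_close {a b c d N q η : ℝ} (hq : 0 < q) (h1 : |a * N - c * q| ≤ η * N * q)
    (h2 : |b * N - d * q| ≤ η * N * q) (hN : 0 ≤ N) {t : ℝ} (h : a ≤ b + t * q) :
    c ≤ d + (t + 2 * η) * N := by
  have h3 := (abs_le.1 h1).1
  have h4 := (abs_le.1 h2).2
  have h5 := mul_le_mul_of_nonneg_right h hN
  have : c * q ≤ (d + (t + 2 * η) * N) * q := by nlinarith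
  exact le_of_mul_le_mul_right this hq

/-- A maximin winner `w` of `u` is lifted on `R`. Closeness costs at most `ρ N / 8` in each
comparison, whereas lifting gains `7/16 ρ N` against every opponent that `w` does not beat.
Opponents beaten by `w` need a separate argument, since there the gain may be small. -/
theorem maximinRule_hasRobustWinners : HasRobustWinners maximinRule := by
  intro m q u ρ hm hq hρ _
  obtain ⟨w, hw⟩ := maximinRule_nonempty (by omega) u
  refine ⟨w, fun N v hN hc R hR => ⟨liftOn R w v, liftOn_of_notMem w v, fun z => ?_⟩⟩
  have hN0 : (0 : ℝ) ≤ N := Nat.cast_nonneg N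
  rcases eq_or_ne z w with rfl | hz
  · exact le_rfl
  rw [le_maximinScore_iff]
  intro y hy
  suffices h : ∃ y', y' ≠ z ∧ prefCount (liftOn R w v) z y' ≤ prefCount (liftOn R w v) w y by
    obtain ⟨y', h1, h2⟩ := h
    refine (maximinScore_le _ h1).trans ?_
    rw [WithTop.coe_le_coe, margin_eq _ h1.symm, margin_eq _ hy.symm]
    omega
  obtain ⟨y', hy', hmin⟩ := exists_maximinScore_eq u hz.symm
  have key : ∀ x, x ≠ w → (prefCount v z y' : ℝ) ≤ prefCount v w x + (0 + 2 * (ρ / 16)) * N := by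
    intro x hx
    refine le_of_close (Nat.cast_pos.2 hq) (hc.pref z y') (hc.pref w x) hN0 ?_
    have := (hw z).trans (maximinScore_le u hx)
    rw [hmin, WithTop.coe_le_coe, margin_eq _ hy'.symm, margin_eq _ hx.symm] at this
    rw [zero_mul, add_zero]
    exact_mod_cast (show prefCount u z y' ≤ prefCount u w x by omega)
  have hzy := prefCount_liftOn_le R hz y' v
  have key2 : ∀ x, x ≠ w → 2 * prefCount v w x ≤ N →
      prefCount v z y' ≤ prefCount (liftOn R w v) w x := by
    intro x hx h
    have h1 := prefCount_add_le_prefCount_liftOn hR hρ.le hx h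
    have h2 := key x hx
    have : (prefCount v z y' : ℝ) ≤ prefCount (liftOn R w v) w x := by nlinarith
    exact_mod_cast this
  by_cases h1 : 2 * prefCount v w y ≤ N
  · exact ⟨y', hy', hzy.trans (key2 y hy h1)⟩
  have h3 := prefCount_le_liftOn_self (v := v) (R := R) hy
  have h4 := prefCount_add_prefCount (liftOn R w v) hz
  -- Here `w` has a majority over `y`. Either `z` has at most half against `w`, which bounds the
  -- score of `z`, or `w` trails `z` even after lifting, and `key2` at `z` bounds the score of `z`
  -- below a majority.
  by_cases h2 : N ≤ 2 * prefCount (liftOn R w v) w z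
  · exact ⟨w, hz.symm, by omega⟩
  · have h5 := prefCount_le_liftOn_self (v := v) (R := R) hz
    have h6 := key2 z hz (by omega)
    exact ⟨y', hy', by omega⟩

/-- With the next lemma: a majority in `v` passes the threshold `1/2 - η` in `u`, and passing that
threshold in `u` means more than `1/2 - 2η` in `v`, a deficit that lifting makes up. -/
theorem half_lt_of_close {a c N q η : ℝ} (hN : 0 < N) (h : |a * N - c * q| ≤ η * N * q)
    (hc : N < 2 * c) (hq : 0 < q) : (1 - 2 * η) * q < 2 * a := by
  have h3 := (abs_le.1 h).1
  have : (1 - 2 * η) * q * N < 2 * a * N := by nlinarith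
  exact lt_of_mul_lt_mul_right this hN.le

theorem lt_of_half_lt_of_close {a c N q η : ℝ} (hN : 0 < N) (h : |a * N - c * q| ≤ η * N * q)
    (hq : 0 < q) (ha : (1 - 2 * η) * q < 2 * a) : (1 - 4 * η) * N < 2 * c := by
  have h3 := (abs_le.1 h).2
  have : (1 - 4 * η) * N * q < 2 * c * q := by nlinarith
  exact lt_of_mul_lt_mul_right this hq.le

theorem le_of_half_le_of_close {a c N q η : ℝ} (hN : 0 ≤ N) (h : |a * N - c * q| ≤ η * N * q)
    (hq : 0 < q) (ha : q ≤ 2 * a) : (1 - 2 * η) * N ≤ 2 * c := by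
  have h3 := (abs_le.1 h).2
  have h4 := mul_le_mul_of_nonneg_right ha hN
  have : (1 - 2 * η) * N * q ≤ 2 * c * q := by nlinarith
  exact le_of_mul_le_mul_right this hq

/-- `w` maximizes in `u` the number of victories with the relaxed majority `(1 - ρ/8) q / 2`. Every
victory of `z` in the lifted profile is a relaxed victory in `u`, and every relaxed victory of `w`
in `u` becomes a true one after lifting; so the two scores are compared through `u`. -/
theorem copelandRule_hasRobustWinners : HasRobustWinners copelandRule := by
  classical
  intro m q u ρ hm hq hρ _
  have : Nonempty (Fin m) := ⟨⟨0, by omega⟩⟩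
  obtain ⟨w, hw⟩ := Finite.exists_max fun x : Fin m =>
    (Finset.univ.filter fun y => y ≠ x ∧ (1 - 2 * (ρ / 16)) * q < 2 * (prefCount u x y : ℝ)).card
  refine ⟨w, fun N v hN hc R hR => ⟨liftOn R w v, liftOn_of_notMem w v, fun z => ?_⟩⟩
  have hN0 : (0 : ℝ) < N := by nlinarith
  have hq0 : (0 : ℝ) < q := Nat.cast_pos.2 hq
  rcases eq_or_ne z w with rfl | hz
  · exact le_rfl
  refine (Finset.card_le_card ?_).trans ((hw z).trans (Finset.card_le_card ?_))
  · intro y hy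
    simp only [Finset.mem_filter, Finset.mem_univ, true_and] at hy ⊢
    refine ⟨hy.1, half_lt_of_close hN0 (hc.pref z y) ?_ hq0⟩
    have h1 := hy.2
    rw [margin_eq _ hy.1.symm] at h1
    have h2 := prefCount_liftOn_le R hz y v
    exact_mod_cast (show N < 2 * prefCount v z y by omega)
  · intro y hy
    simp only [Finset.mem_filter, Finset.mem_univ, true_and] at hy ⊢
    refine ⟨hy.1, ?_⟩
    have h1 := lt_of_half_lt_of_close hN0 (hc.pref w y) hq0 hy.2
    rw [margin_eq _ hy.1.symm]
    by_cases h2 : 2 * prefCount v w y ≤ N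
    · have h3 := prefCount_add_le_prefCount_liftOn hR hρ.le hy.1 h2
      have h4 : (N : ℝ) < 2 * prefCount (liftOn R w v) w y := by nlinarith
      have h5 : N < 2 * prefCount (liftOn R w v) w y := by exact_mod_cast h4
      omega
    · have h3 := prefCount_le_liftOn_self (v := v) (R := R) hy.1
      omega

/-- The same sandwich as for Copeland, with the Bucklin score for the relaxed majority `(1 - ρ/8) q
/ 2`. -/
theorem bucklinRule_hasRobustWinners : HasRobustWinners bucklinRule := by
  classical
  intro m q u ρ hm hq hρ hρ1
  have : Nonempty (Fin m) := ⟨⟨0, by omega⟩⟩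
  have hq0 : (0 : ℝ) < q := Nat.cast_pos.2 hq
  have hex : ∀ x : Fin m, ∃ l, (1 - 2 * (ρ / 16)) * q < 2 * (topCount u l x : ℝ) := by
    intro x
    refine ⟨m, ?_⟩
    rw [topCount_of_le u le_rfl]
    nlinarith
  obtain ⟨w, hw⟩ := Finite.exists_min fun x : Fin m => Nat.find (hex x)
  refine ⟨w, fun N v hN hc R hR => ⟨liftOn R w v, liftOn_of_notMem w v, fun z => ?_⟩⟩
  have hN0 : (0 : ℝ) < N := by nlinarith
  rcases eq_or_ne z w with rfl | hz
  · exact le_rfl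
  trans Nat.find (hex w)
  · refine Nat.sInf_le ?_
    rw [Set.mem_ofPred_eq]
    have h0 := Nat.find_spec (hex w)
    have h1 := lt_of_half_lt_of_close hN0 (hc.top _ w) hq0 h0
    -- Lifting increases top-`l` counts only for `l > 0`; the relaxed threshold is still positive
    -- because `ρ ≤ 1`, so `l = 0` fails it.
    have hl : 0 < Nat.find (hex w) := by
      rw [Nat.find_pos, topCount_zero]
      push_cast
      nlinarith
    by_cases h2 : 2 * topCount v (Nat.find (hex w)) w ≤ N
    · have h3 := topCount_add_le_topCount_liftOn hR hρ.le hl h2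
      have h4 : (N : ℝ) < 2 * topCount (liftOn R w v) (Nat.find (hex w)) w := by nlinarith
      exact_mod_cast h4
    · have h3 := topCount_liftOn_self R w v hl
      omega
  · refine (hw z).trans (Nat.find_min' (hex z) ?_)
    refine half_lt_of_close hN0 (hc.top _ z) ?_ hq0
    have h1 := bucklinScore_mem (liftOn R w v) (Nat.cast_pos.1 hN0) z
    have h2 := topCount_liftOn_le R hz v (bucklinScore (liftOn R w v) z)
    exact_mod_cast (show N < 2 * topCount v (bucklinScore (liftOn R w v) z) z by omega)

/-! ### Plurality with runoff -/

/-- Rank `w` first and `y` second in the votes of `R₁`, and the other way round in the remaining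
votes of `R`. -/
def runoffOn (R R₁ : Finset (Fin N)) (w y : Fin m) (v : Profile m N) : Profile m N :=
  fun i => if i ∈ R₁ then moveTop w (moveTop y (v i)) else
    if i ∈ R then moveTop y (moveTop w (v i)) else v i

/-- Votes outside `R` contribute equally on both sides; the additive form avoids truncated
subtraction. -/
theorem pluralityScore_add_filter (R : Finset (Fin N)) (v v' : Profile m N)
    (h : ∀ i, i ∉ R → v' i = v i) (x : Fin m) :
    pluralityScore v' x + (R.filter fun i => (v i x : ℕ) < 1).card
      = pluralityScore v x + (R.filter fun i => (v' i x : ℕ) < 1).card := by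
  have e : ∀ v : Profile m N, pluralityScore v x = (R.filter fun i => (v i x : ℕ) < 1).card
      + (Rᶜ.filter fun i => (v i x : ℕ) < 1).card := by
    intro v
    rw [pluralityScore, topCount, ← Finset.card_union_of_disjoint, ← Finset.filter_union,
      Finset.union_compl]
    exact Finset.disjoint_filter_filter disjoint_compl_right
  have e2 : Rᶜ.filter (fun i => (v' i x : ℕ) < 1) = Rᶜ.filter fun i => (v i x : ℕ) < 1 :=
    Finset.filter_congr fun i hi => by rw [h i (Finset.mem_compl.1 hi)]
  rw [e v, e v', e2]
  omega

theorem prefCount_add_filter (R : Finset (Fin N)) (v v' : Profile m N)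
    (h : ∀ i, i ∉ R → v' i = v i) (x y : Fin m) :
    prefCount v' x y + (R.filter fun i => v i x < v i y).card
      = prefCount v x y + (R.filter fun i => v' i x < v' i y).card := by
  have e : ∀ v : Profile m N, prefCount v x y = (R.filter fun i => v i x < v i y).card
      + (Rᶜ.filter fun i => v i x < v i y).card := by
    intro v
    rw [prefCount, ← Finset.card_union_of_disjoint, ← Finset.filter_union, Finset.union_compl]
    exact Finset.disjoint_filter_filter disjoint_compl_right
  have e2 : Rᶜ.filter (fun i => v' i x < v' i y) = Rᶜ.filter fun i => v i x < v i y :=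
    Finset.filter_congr fun i hi => by rw [h i (Finset.mem_compl.1 hi)]
  rw [e v, e v', e2]
  omega

theorem runoffOn_of_notMem {R₁ : Finset (Fin N)} (hR : R₁ ⊆ R) (w y : Fin m) (v : Profile m N)
    (i : Fin N) (h : i ∉ R) : runoffOn R R₁ w y v i = v i := by
  have h1 : i ∉ R₁ := fun h' => h (hR h')
  simp [runoffOn, h, h1]

/-- All votes of `R` get `w` and `y` on top, so no third candidate is first there. `y` needs `ρ N /
4` first places in `R`: `ρ N / 8` for the closeness error and twice `ρ N / 16` for the spread error.
The others, at least `11/16 ρ N - 1`, go to `w`; this secures its plurality score and the pairwise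
contest with `y`. -/
theorem runoffRule_hasRobustWinners : HasRobustWinners runoffRule := by
  classical
  intro m q u ρ hm hq hρ hρ1
  have hq0 : (0 : ℝ) < q := Nat.cast_pos.2 hq
  obtain ⟨w, y, ht, hwy⟩ := exists_isTopTwo_margin hm u
  refine ⟨w, fun N v hN hc R hR => ?_⟩
  have hN0 : (0 : ℝ) < N := by nlinarith
  have hρN : 0 ≤ ρ * (ρ * N) := by positivity
  have e1 : (1 - ρ) * ((0 + 2 * (ρ / 16)) * N) ≤ ρ * N / 8 := by nlinarith
  have e2 : N - ρ * N - ρ * N / 8 ≤ (1 - ρ) * ((1 - 2 * (ρ / 16)) * N) := by nlinarith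
  have hcard := abs_le.1 hR.card
  -- the number of votes of `R` that rank `y` first
  obtain ⟨R₂, hR₂, hc₂⟩ : ∃ R₂ ⊆ R, R₂.card = ⌈ρ * N / 4⌉₊ := by
    apply Finset.exists_subset_card_eq
    rw [Nat.ceil_le]
    linarith
  have hlo : ρ * N / 4 ≤ R₂.card := by rw [hc₂]; exact Nat.le_ceil _
  have hhi : (R₂.card : ℝ) ≤ ρ * N / 4 + 1 := by
    rw [hc₂]; exact (Nat.ceil_lt_add_one (by positivity)).le
  have hR₁ : R \ R₂ ⊆ R := Finset.sdiff_subset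
  have hc₁ : ((R \ R₂).card : ℝ) = R.card - R₂.card := by
    rw [Finset.card_sdiff_of_subset hR₂, Nat.cast_sub (Finset.card_le_card hR₂)]
  set v' := runoffOn R (R \ R₂) w y v with hv'
  have hne := ht.1
  have hvn : ∀ i, i ∉ R → v' i = v i := runoffOn_of_notMem hR₁ w y v
  have h1 : ∀ i, i ∈ R \ R₂ → v' i = moveTop w (moveTop y (v i)) := by
    intro i hi; rw [hv']; simp only [runoffOn, hi, if_true]
  have h2 : ∀ i, i ∈ R₂ → v' i = moveTop y (moveTop w (v i)) := by
    intro i hi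
    have : i ∉ R \ R₂ := fun h => (Finset.mem_sdiff.1 h).2 hi
    rw [hv']; simp only [runoffOn, this, if_false, hR₂ hi, if_true]
  have hw1 : (R \ R₂).card ≤ (R.filter fun i => (v' i w : ℕ) < 1).card := by
    refine Finset.card_le_card fun i hi => Finset.mem_filter.2 ⟨hR₁ hi, ?_⟩
    rw [h1 i hi, moveTop_self]; exact one_pos
  have hy1 : R₂.card ≤ (R.filter fun i => (v' i y : ℕ) < 1).card := by
    refine Finset.card_le_card fun i hi => Finset.mem_filter.2 ⟨hR₂ hi, ?_⟩
    rw [h2 i hi, moveTop_self]; exact one_pos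
  have hz1 : ∀ z, z ≠ w → z ≠ y → (R.filter fun i => (v' i z : ℕ) < 1).card = 0 := by
    intro z hzw hzy
    rw [Finset.card_eq_zero, Finset.filter_eq_empty_iff]
    intro i hi
    by_cases hi2 : i ∈ R₂
    · rw [h2 i hi2]; have := moveTop_pos hzy (moveTop w (v i)); omega
    · rw [h1 i (Finset.mem_sdiff.2 ⟨hi, hi2⟩)]
      have := moveTop_pos hzw (moveTop y (v i)); omega
  have hp1 : (R \ R₂).card ≤ (R.filter fun i => v' i w < v' i y).card := by
    refine Finset.card_le_card fun i hi => Finset.mem_filter.2 ⟨hR₁ hi, ?_⟩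
    rw [h1 i hi, Fin.lt_def, moveTop_self]; exact moveTop_pos hne.symm _
  -- casts
  have ew := pluralityScore_add_filter R v v' hvn w
  have ey := pluralityScore_add_filter R v v' hvn y
  have ep := prefCount_add_filter R v v' hvn w y
  have sw := abs_le.1 (hR.top 1 w)
  have sy := abs_le.1 (hR.top 1 y)
  have sp := abs_le.1 (hR.pref w y)
  replace ew := congrArg (Nat.cast (R := ℝ)) ew
  replace ey := congrArg (Nat.cast (R := ℝ)) ey
  replace ep := congrArg (Nat.cast (R := ℝ)) ep
  rw [Nat.cast_add, Nat.cast_add] at ew ey ep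
  replace hw1 := (Nat.cast_le (α := ℝ)).2 hw1
  replace hy1 := (Nat.cast_le (α := ℝ)).2 hy1
  replace hp1 := (Nat.cast_le (α := ℝ)).2 hp1
  refine ⟨v', hvn, Or.inr ⟨y, ⟨hne, fun z hzw hzy => ?_⟩, ?_⟩⟩
  · have ez := pluralityScore_add_filter R v v' hvn z
    replace ez := congrArg (Nat.cast (R := ℝ)) ez
    rw [hz1 z hzw hzy, Nat.cast_add, Nat.cast_add, Nat.cast_zero] at ez
    have sz := abs_le.1 (hR.top 1 z)
    have hzz := ht.2 z hzw hzy
    have cw : (pluralityScore v z : ℝ) ≤ pluralityScore v w + (0 + 2 * (ρ / 16)) * N := by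
      refine le_of_close hq0 (hc.top 1 z) (hc.top 1 w) hN0.le ?_
      rw [zero_mul, add_zero]; exact_mod_cast hzz.1
    have cy : (pluralityScore v z : ℝ) ≤ pluralityScore v y + (0 + 2 * (ρ / 16)) * N := by
      refine le_of_close hq0 (hc.top 1 z) (hc.top 1 y) hN0.le ?_
      rw [zero_mul, add_zero]; exact_mod_cast hzz.2
    have cw' := mul_le_mul_of_nonneg_left cw (sub_nonneg.2 hρ1)
    have cy' := mul_le_mul_of_nonneg_left cy (sub_nonneg.2 hρ1)
    rw [← pluralityScore] at sw sy sz
    constructor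
    · have : (pluralityScore v' z : ℝ) ≤ pluralityScore v' w := by linarith
      exact_mod_cast this
    · have : (pluralityScore v' z : ℝ) ≤ pluralityScore v' y := by linarith
      exact_mod_cast this
  · rw [margin_eq _ hne] at hwy ⊢
    have c1 : (q : ℝ) ≤ 2 * prefCount u w y := by
      exact_mod_cast (show q ≤ 2 * prefCount u w y by omega)
    have c2 : (1 - 2 * (ρ / 16)) * N ≤ 2 * prefCount v w y :=
      le_of_half_le_of_close hN0.le (hc.pref w y) hq0 c1
    have c3 := mul_le_mul_of_nonneg_left c2 (sub_nonneg.2 hρ1)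
    -- The surplus is `ρ N / 8 - 2`, where 2 comes from rounding up `R₂.card`; this uses `16 ≤ ρ N`
    -- in full.
    have c4 : (N : ℝ) ≤ 2 * prefCount v' w y := by linarith
    have c5 : N ≤ 2 * prefCount v' w y := by exact_mod_cast c4
    omega

end Robust

/-! ### From streams to profiles -/

theorem countP_ofFn {U : Type} {N : ℕ} (v : Fin N → U) (P : U → Prop) [DecidablePred P] :
    (List.ofFn v).countP (fun a => decide (P a)) = (Finset.univ.filter fun i => P (v i)).card := by
  induction N with
  | zero => simp
  | succ N ih =>
    rw [List.ofFn_succ, List.countP_cons, ih, Finset.card_filter, Finset.card_filter,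
      Fin.sum_univ_succ, add_comm]
    simp

section Tests

variable {m N : ℕ}

/-- The properties of votes whose frequencies determine the behaviour of the rules. -/
def voteTest (j : Fin m × Fin m × Bool) (a : Vote m) : Bool :=
  if j.2.2 then decide (a j.1 < a j.2.1) else decide ((a j.1 : ℕ) < j.2.1 + 1)

/-- The tests cover `1 ≤ l ≤ m`. The count is 0 for `l = 0` and constant for `l ≥ m`; the test with
`l = m` also controls the sample size. -/
theorem abs_sub_le_of_voteTest {p t : ℝ} (hm : 0 < m) (ht : 0 ≤ t) (v : Profile m N)
    (τ : List (Vote m))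
    (h : ∀ j, |(τ.countP (voteTest j) : ℝ) - p * (List.ofFn v).countP (voteTest j)| ≤ t) :
    |(τ.length : ℝ) - p * N| ≤ t ∧
      (∀ x y, |(τ.countP (fun a => decide (a x < a y)) : ℝ) - p * prefCount v x y| ≤ t) ∧
      ∀ l x, |(τ.countP (fun a => decide ((a x : ℕ) < l)) : ℝ) - p * topCount v l x| ≤ t := by
  have htop : ∀ (y x : Fin m), |(τ.countP (fun a => decide ((a x : ℕ) < y + 1)) : ℝ)
      - p * topCount v (y + 1) x| ≤ t := by
    intro y x
    have h1 := h (x, y, false)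
    have e : voteTest (x, y, false) = fun a => decide ((a x : ℕ) < y + 1) := rfl
    rwa [e, countP_ofFn v fun a => (a x : ℕ) < y + 1] at h1
  have hall : ∀ (l : ℕ), m ≤ l → ∀ x : Fin m,
      τ.countP (fun a => decide ((a x : ℕ) < l)) = τ.length := by
    intro l hl x
    rw [List.countP_eq_length]
    intro a _
    exact decide_eq_true ((a x).2.trans_le hl)
  have hlen : |(τ.length : ℝ) - p * N| ≤ t := by
    have h1 := htop ⟨m - 1, by omega⟩ ⟨0, hm⟩
    rwa [hall _ (by simp only; omega), topCount_of_le v (by simp only; omega)] at h1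
  refine ⟨hlen, fun x y => ?_, fun l x => ?_⟩
  · have h1 := h (x, y, true)
    have e : voteTest (x, y, true) = fun a => decide (a x < a y) := rfl
    rwa [e, countP_ofFn v fun a => a x < a y] at h1
  · rcases Nat.eq_zero_or_pos l with rfl | hl
    · simpa [topCount_zero] using ht
    · rcases le_or_gt m l with h1 | h1
      · rwa [hall l h1, topCount_of_le v h1]
      · have h2 := htop ⟨l - 1, by omega⟩ x
        rwa [show ((⟨l - 1, by omega⟩ : Fin m) : ℕ) + 1 = l by simp only; omega] at h2

/-- Passes from the expected sample size `p N` to the actual size `q ≥ p N / 2`. -/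
theorem abs_mul_sub_mul_le {a c p N q η : ℝ} (hp : 0 ≤ p) (hη : η ≤ 1 / 2) (hη0 : 0 ≤ η)
    (hc : 0 ≤ c) (hcN : c ≤ N) (h1 : |q - p * N| ≤ η * (p * N)) (h2 : |a - p * c| ≤ η * (p * N)) :
    |a * N - c * q| ≤ 4 * η * N * q := by
  have hN : 0 ≤ N := hc.trans hcN
  have hpN : 0 ≤ p * N := mul_nonneg hp hN
  have h3 : p * N ≤ 2 * q := by nlinarith [(abs_le.1 h1).1]
  calc |a * N - c * q| = |(a - p * c) * N - c * (q - p * N)| := by ring_nf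
    _ ≤ |(a - p * c) * N| + |c * (q - p * N)| := abs_sub _ _
    _ = |a - p * c| * N + c * |q - p * N| := by
      rw [abs_mul, abs_mul, abs_of_nonneg hN, abs_of_nonneg hc]
    _ ≤ η * (p * N) * N + N * (η * (p * N)) := by gcongr
    _ = 2 * η * N * (p * N) := by ring
    _ ≤ 2 * η * N * (2 * q) := by gcongr
    _ = 4 * η * N * q := by ring

theorem isClose_of_voteTest {p η : ℝ} (hm : 0 < m) (hp : 0 ≤ p) (hη : η ≤ 1 / 2) (hη0 : 0 ≤ η)
    (v : Profile m N) (τ : List (Vote m))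
    (h : ∀ j, |(τ.countP (voteTest j) : ℝ) - p * (List.ofFn v).countP (voteTest j)|
      ≤ η * (p * N)) : IsClose (4 * η) v τ.get := by
  obtain ⟨h1, h2, h3⟩ := abs_sub_le_of_voteTest hm (by positivity) v τ h
  constructor
  · intro x y
    refine abs_mul_sub_mul_le hp hη hη0 (Nat.cast_nonneg _)
      (Nat.cast_le.2 (prefCount_le v x y)) h1 ?_
    have e := countP_ofFn τ.get fun a => a x < a y
    rw [List.ofFn_get] at e
    rw [prefCount, ← e]
    exact h2 x y
  · intro l x
    refine abs_mul_sub_mul_le hp hη hη0 (Nat.cast_nonneg _)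
      (Nat.cast_le.2 (topCount_le v l x)) h1 ?_
    have e := countP_ofFn τ.get fun a => (a x : ℕ) < l
    rw [List.ofFn_get] at e
    rw [topCount, ← e]
    exact h3 l x

theorem card_tests : (Fintype.card (Fin m × Fin m × Bool) : ℝ) = 2 * (m : ℝ) ^ 2 := by
  simp only [Fintype.card_prod, Fintype.card_fin, Fintype.card_bool]
  push_cast; ring

theorem le_sampleExp_of_deviation {U ι : Type} [Fintype ι] {p : ℝ} (h0 : 0 ≤ p) (h1 : p ≤ 1)
    (P : ι → U → Bool) {η : ℝ} (hη : 0 ≤ η) (hη1 : η ≤ 1) (xs : List U) (S : Set (List U))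
    (hS : ∀ τ : List U, (∀ j, |(τ.countP (P j) : ℝ) - p * xs.countP (P j)| ≤ η * (p * xs.length)) →
      τ ∈ S) :
    1 - 2 * Fintype.card ι * Real.exp (-(η ^ 2 * (p * xs.length) / 4))
      ≤ sampleExp p (S.indicator 1) [] xs := by
  have h := sampleExp_deviation_le h0 h1 P hη hη1 xs
  set B : Set (List U) :=
    {τ | ∃ j, η * (p * xs.length) < |(τ.countP (P j) : ℝ) - p * xs.countP (P j)|}
  have h2 := sampleExp_mono h0 h1 (F := fun _ => 1)
    (G := fun τ => S.indicator 1 τ + B.indicator 1 τ) (fun τ => ?_) xs []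
  · rw [sampleExp_const, sampleExp_add] at h2
    linarith
  · by_cases hB : τ ∈ B
    · rw [Set.indicator_of_mem hB, Pi.one_apply]
      exact le_add_of_nonneg_left (Set.indicator_nonneg (fun _ _ => zero_le_one) _)
    · rw [Set.indicator_of_notMem hB, Set.indicator_of_mem, Pi.one_apply, add_zero]
      refine hS τ fun j => ?_
      by_contra! hj
      exact hB ⟨j, hj⟩

/-- A random set of voters works with positive probability. Indices are sampled rather than votes,
since votes may repeat. -/
theorem exists_isSpread {ρ η : ℝ} (hm : 0 < m) (h0 : 0 ≤ ρ) (h1 : ρ ≤ 1) (hη : 0 ≤ η)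
    (hη1 : η ≤ 1) (v : Profile m N)
    (h : 4 * (m : ℝ) ^ 2 * Real.exp (-(η ^ 2 * (ρ * N) / 4)) < 1) : ∃ R, IsSpread ρ η v R := by
  classical
  have h2 := le_sampleExp_of_deviation h0 h1 (fun j i => voteTest j (v i)) hη hη1
    (List.finRange N) {τ | ∀ j : Fin m × Fin m × Bool, |(τ.countP (fun i => voteTest j (v i)) : ℝ)
      - ρ * (List.finRange N).countP (fun i => voteTest j (v i))| ≤ η * (ρ * N)}
    (by intro τ hτ; simpa using hτ)
  rw [card_tests, List.length_finRange] at h2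
  obtain ⟨τ, hτ, hpos⟩ := exists_sublist_of_sampleExp_pos h0 h1 _ _ _
    (lt_of_lt_of_le (by linarith) h2)
  have hmem := Set.mem_of_indicator_ne_zero hpos.ne'
  rw [List.nil_append, Set.mem_ofPred_eq] at hmem
  have hnd : τ.Nodup := hτ.nodup (List.nodup_finRange N)
  have hcount : ∀ (P : Vote m → Prop) [DecidablePred P],
      (τ.map v).countP (fun a => decide (P a)) = (τ.toFinset.filter fun i => P (v i)).card := by
    intro P _
    rw [List.countP_map, List.countP_eq_length_filter,
      ← List.toFinset_card_of_nodup (hnd.filter _)]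
    congr 1
    ext i
    simp
  have h3 := abs_sub_le_of_voteTest (p := ρ) (t := η * (ρ * N)) hm (by positivity) v (τ.map v)
    (fun j => by
      have := hmem j
      rwa [← Function.comp_def (voteTest j) v, ← List.countP_map, ← List.countP_map,
        ← List.ofFn_eq_map] at this)
  refine ⟨τ.toFinset, ?_, fun x y => ?_, fun l x => ?_⟩
  · rw [List.toFinset_card_of_nodup hnd]
    simpa using h3.1
  · rw [← hcount fun a => a x < a y]
    exact h3.2.1 x y
  · rw [← hcount fun a => (a x : ℕ) < l]
    exact h3.2.2 l x

end Tests

/-! ### The algorithms -/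

section Algorithms

open StreamAlg

variable {r : VotingRule} {m s k L : ℕ} {enc : ℕ × Bool × List (Vote m) → Fin s → Bool}
  {dec : (Fin s → Bool) → ℕ × Bool × List (Vote m)}

theorem exists_out_of_hasRobustWinners (hr : HasRobustWinners r) (hm : 2 ≤ m) {ε : ℝ} (hε : 0 < ε)
    (hε1 : ε ≤ 1) : ∃ out : List (Vote m) → Fin m, ∀ (k s L : ℕ) enc dec, ∀ δ < 1,
    (∀ c fl σ, c ≤ k → σ.length ≤ L → dec (enc (c, fl, σ)) = (c, fl, σ)) → ∀ (N : ℕ),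
    2 * ((1 / 2 : ℝ) ^ k * N) ≤ L →
    4 * (m : ℝ) ^ 2 * Real.exp (-((ε / 128) ^ 2 * ((1 / 2) ^ k * N) / 4)) ≤ δ →
    ∀ v : Profile m N, (sampler (s := s) k L enc dec out).AnswersWithProb (List.ofFn v)
      {w | IsEpsWinner r ε v w} (1 - δ) := by
  have : Nonempty (Fin m) := ⟨⟨0, by omega⟩⟩
  have hr' := fun (q : ℕ) (u : Profile m q) (hq : 0 < q) =>
    hr m q u (ε / 2) hm hq (by positivity) (by linarith)
  choose! f hf using hr'
  refine ⟨fun τ => f τ.length τ.get, ?_⟩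
  intro k s L enc dec δ hδ hd N hL hexp v
  apply sampler_answersWithProb hd
  set p : ℝ := (1 / 2) ^ k with hp
  have hp0 : 0 ≤ p := by positivity
  have hp1 : p ≤ 1 := pow_le_one₀ (by norm_num) (by norm_num)
  have hN0 : (0 : ℝ) ≤ N := Nat.cast_nonneg N
  have hpN : p * N ≤ N := mul_le_of_le_one_left hN0 hp1
  have hm2 : (2 : ℝ) ≤ m := by exact_mod_cast hm
  -- As `4 m² ≥ 16` and `δ < 1`, the exponential is below `1/16`; with `1 - x ≤ e⁻ˣ` this gives `x >
  -- 15/16`, where `x = ε² p N / 65536`.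
  have hbig : 61440 < ε ^ 2 * (p * N) := by
    have h1 := Real.add_one_le_exp (-((ε / 128) ^ 2 * (p * N) / 4))
    by_contra! h2
    have h3 : 1 / 16 ≤ Real.exp (-((ε / 128) ^ 2 * (p * N) / 4)) := by
      have : (ε / 128) ^ 2 * (p * N) / 4 = ε ^ 2 * (p * N) / 65536 := by ring
      linarith
    have h4 : (4 : ℝ) ≤ m ^ 2 := by nlinarith
    nlinarith
  have hεN : 61440 < ε * N := by
    have : ε ^ 2 * (p * N) ≤ ε * N := by
      have h1 : ε ^ 2 * (p * N) ≤ ε ^ 2 * N := by gcongr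
      have h2 : ε ^ 2 * N ≤ ε * N := by
        apply mul_le_mul_of_nonneg_right _ hN0
        nlinarith
      linarith
    linarith
  -- `ρ = ε/2` keeps `R.card ≤ 17/16 · ε/2 · N` below `ε N`. The sampling accuracy `ε/128` yields
  -- closeness `4 · ε/128 = ρ/16`.
  obtain ⟨R, hR⟩ := exists_isSpread (ρ := ε / 2) (η := 1 / 16) (by omega) (by positivity)
    (by linarith) (by norm_num) (by norm_num) v (by
      refine lt_of_le_of_lt (le_trans ?_ hexp) hδ
      gcongr 4 * (m : ℝ) ^ 2 * Real.exp (-(?_ / 4))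
      have : (ε / 128) ^ 2 * (p * N) ≤ (ε / 128) ^ 2 * N := by gcongr
      have h2 : ε ^ 2 * N ≤ ε * N := by
        apply mul_le_mul_of_nonneg_right _ hN0
        nlinarith
      nlinarith)
  have hppos : 0 < p * N := by
    have : 0 < ε ^ 2 := by positivity
    by_contra! h
    nlinarith
  have hmain := le_sampleExp_of_deviation hp0 hp1 voteTest (η := ε / 128) (by positivity)
    (by linarith) (List.ofFn v)
    {τ | f (τ.take L).length (τ.take L).get ∈ {w | IsEpsWinner r ε v w}} (by
      intro τ hτ
      rw [List.length_ofFn] at hτ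
      have hlen := abs_le.1 (abs_sub_le_of_voteTest (by omega) (by positivity) v τ hτ).1
      -- A good sample has at most `2 p N` votes, so nothing is truncated.
      have hL' : τ.length ≤ L := by
        have : (τ.length : ℝ) ≤ L := by nlinarith
        exact_mod_cast this
      have hpos : 0 < τ.length := by
        have : (0 : ℝ) < τ.length := by nlinarith
        exact_mod_cast this
      have hcl := isClose_of_voteTest (by omega) hp0 (by linarith) (by positivity) v τ hτ
      rw [Set.mem_ofPred_eq, List.take_of_length_le hL']
      obtain ⟨v', hv', hw⟩ := hf τ.length τ.get hpos N v
        (by linarith) (by convert hcl using 1; ring) R hR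
      refine ⟨v', ?_, hw⟩
      have h1 : (hammingDist v v' : ℝ) ≤ R.card := Nat.cast_le.2 (hammingDist_le_card hv')
      have h2 := (abs_le.1 hR.card).2
      linarith)
  refine le_trans ?_ hmain
  rw [card_tests, List.length_ofFn]
  linarith

/-- With `k = 0` no coin is tossed and the whole stream is stored, so the answer is an exact winner.
-/
theorem exists_out_of_nonempty (hr : ∀ N (v : Profile m N), (r m N v).Nonempty) {ε : ℝ}
    (hε : 0 < ε) : ∃ out : List (Vote m) → Fin m, ∀ (s L : ℕ) enc dec, ∀ δ, 0 ≤ δ →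
    (∀ c fl σ, c ≤ 0 → σ.length ≤ L → dec (enc (c, fl, σ)) = (c, fl, σ)) → ∀ N ≤ L,
    ∀ v : Profile m N, (sampler (s := s) 0 L enc dec out).AnswersWithProb (List.ofFn v)
      {w | IsEpsWinner r ε v w} (1 - δ) := by
  choose f hf using hr
  refine ⟨fun τ => f τ.length τ.get, ?_⟩
  intro s L enc dec δ hδ hd N hN v
  apply sampler_answersWithProb hd
  rw [pow_zero, sampleExp_one, List.nil_append, Set.indicator_of_mem, Pi.one_apply]
  · linarith
  rw [Set.mem_ofPred_eq, List.take_of_length_le (by simpa using hN)]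
  refine ⟨v, by simp; positivity, ?_⟩
  have e : (⟨_, (List.ofFn v).get⟩ : Σ n, Fin n → Vote m) = ⟨N, v⟩ :=
    List.equivSigmaTuple.right_inv ⟨N, v⟩
  have h := congrArg (fun t : Σ n, Fin n → Vote m => f t.1 t.2) e
  simp only at h
  rw [h]
  exact hf N v

/-- The algorithm without memory that always answers `w`. -/
def constAlg (U : Type) {C : Type} (w : C) : StreamAlg U C 0 where
  init := fun _ => false
  tosses _ := false
  onToss a _ := a
  onRead a _ := a
  output _ := w

theorem constAlg_foldl {U C : Type} (w : C) (bs : List Bool) (a : Fin 0 → Bool) (xs : List U) :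
    bs.foldl (constAlg U w).step (a, xs) = (a, xs.drop bs.length) := by
  induction bs generalizing xs with
  | nil => simp
  | cons b bs ih =>
    rw [List.foldl_cons]
    cases xs with
    | nil =>
      have : (constAlg U w).step (a, []) b = (a, []) := rfl
      rw [this, ih]; simp
    | cons x xs =>
      have : (constAlg U w).step (a, x :: xs) b = (a, xs) := rfl
      rw [this, ih]; simp

theorem constAlg_answersWithProb {U C : Type} (w : C) (xs : List U) (good : Set C) (hw : w ∈ good)
    {p : ℝ} (hp : p ≤ 1) : (constAlg U w).AnswersWithProb xs good p := by
  refine ⟨xs.length, fun ω => ⟨rfl, ?_⟩, ?_⟩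
  · rw [exec, constAlg_foldl, List.length_ofFn, List.drop_length]
  · have : {ω : Fin xs.length → Bool | (constAlg U w).output ((constAlg U w).exec xs ω).1 ∈ good}
        = Set.univ := Set.eq_univ_of_forall fun _ => hw
    rw [this, Set.ncard_univ]
    simpa using hp

end Algorithms

/-! ### The choice of the parameters -/

/-- A memory slot holds one of `m!` votes or nothing, hence needs at most `m log m` bits. -/
theorem factorial_add_one_le_pow {m : ℕ} (hm : 2 ≤ m) : m.factorial + 1 ≤ m ^ m := by
  induction m, hm using Nat.le_induction with
  | base => decide
  | succ m hm ih =>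
    calc (m + 1).factorial + 1 ≤ (m + 1) * (m.factorial + 1) := by
          rw [Nat.factorial_succ]; nlinarith
      _ ≤ (m + 1) * (m + 1) ^ m := by
          gcongr
          exact ih.trans (Nat.pow_le_pow_left (Nat.le_succ m) m)
      _ = (m + 1) ^ (m + 1) := by ring

theorem exists_space {m : ℕ} (hm : 2 ≤ m) (k L : ℕ) :
    ∃ s : ℕ, (s : ℝ) ≤ 2 + Real.logb 2 (k + 1) + L * (m * Real.logb 2 m) ∧
      2 * (k + 1) * (Fintype.card (Vote m) + 1) ^ L ≤ 2 ^ s := by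
  refine ⟨Nat.clog 2 (2 * (k + 1) * (Fintype.card (Vote m) + 1) ^ L), ?_,
    Nat.le_pow_clog one_lt_two _⟩
  set M := 2 * (k + 1) * (Fintype.card (Vote m) + 1) ^ L with hM
  have hMpos : 0 < M := by positivity
  have h1 : (Nat.clog 2 M : ℝ) ≤ Real.logb 2 M + 1 := by
    have h := Real.ceil_logb_natCast (b := 2) (r := (M : ℝ)) (Nat.cast_nonneg M)
    have h2 := Int.ceil_lt_add_one (Real.logb 2 M)
    rw [show (2 : ℝ) = ((2 : ℕ) : ℝ) by norm_num, h, Int.clog_natCast] at h2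
    exact_mod_cast h2.le
  have hcard : ((Fintype.card (Vote m) + 1 : ℕ) : ℝ) ≤ (m : ℝ) ^ m := by
    rw [Fintype.card_perm, Fintype.card_fin]
    exact_mod_cast factorial_add_one_le_pow hm
  have h2 : Real.logb 2 M ≤ 1 + Real.logb 2 (k + 1) + L * (m * Real.logb 2 m) := by
    have hm0 : (0 : ℝ) < m := by positivity
    have h3 : (M : ℝ) ≤ 2 * (k + 1) * ((m : ℝ) ^ m) ^ L := by
      rw [hM]; push_cast; push_cast at hcard; gcongr
    refine (Real.logb_le_logb_of_le one_lt_two (Nat.cast_pos.2 hMpos) h3).trans (le_of_eq ?_)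
    rw [Real.logb_mul (by positivity) (by positivity), Real.logb_mul (by positivity) (by positivity),
      Real.logb_pow, Real.logb_pow, Real.logb_self_eq_one one_lt_two]
  linarith

/-- Since `log 2 ≤ 1`, binary logarithms dominate natural ones. The fourth power of `m` gained
absorbs `4 m²`. -/
theorem four_mul_sq_mul_exp_le {m δ t : ℝ} (hm : 2 ≤ m) (hδ : 0 < δ)
    (ht : 4 * Real.logb 2 m + Real.logb 2 (1 / δ) ≤ t)
    (h0 : 0 ≤ Real.logb 2 (1 / δ)) : 4 * m ^ 2 * Real.exp (-t) ≤ δ := by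
  have hm0 : 0 < m := by linarith
  have hl2 : Real.log 2 ≤ 1 := by have := Real.log_two_lt_d9; linarith
  have hl0 : 0 < Real.log 2 := Real.log_pos one_lt_two
  have hlm : 0 ≤ Real.logb 2 m := Real.logb_nonneg one_lt_two (by linarith)
  have h1 : 4 * Real.log m - Real.log δ ≤ t := by
    have e1 : Real.logb 2 m * Real.log 2 = Real.log m := div_mul_cancel₀ _ hl0.ne'
    have e2 : Real.logb 2 (1 / δ) * Real.log 2 = - Real.log δ := by
      rw [Real.logb, div_mul_cancel₀ _ hl0.ne', one_div, Real.log_inv]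
    nlinarith
  have h2 : Real.exp (-t) ≤ δ / m ^ 4 := by
    calc Real.exp (-t) ≤ Real.exp (Real.log δ - 4 * Real.log m) := Real.exp_le_exp.2 (by linarith)
      _ = δ / m ^ 4 := by
        rw [Real.exp_sub, Real.exp_log hδ, show (4 : ℝ) * Real.log m = ((4 : ℕ) : ℝ) * Real.log m by
          norm_num, Real.exp_nat_mul, Real.exp_log hm0]
  calc 4 * m ^ 2 * Real.exp (-t) ≤ 4 * m ^ 2 * (δ / m ^ 4) := by gcongr
    _ = 4 / m ^ 2 * δ := by field_simp
    _ ≤ 1 * δ := by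
      gcongr
      rw [div_le_one (by positivity)]
      nlinarith
    _ = δ := one_mul δ

/-- Source of the `log log n` term: `k` is at most logarithmic in `n`, and only a counter up to `k`
is stored. -/
theorem logb_add_one_le {c n ℓ : ℝ} (hc : 0 < c) (hn : 2 ≤ n) (hℓ : 1 ≤ ℓ) {k : ℕ}
    (hk : (2 : ℝ) ^ k ≤ c * n / ℓ) :
    Real.logb 2 (k + 1) ≤ Real.logb 2 (|Real.logb 2 c| + 2) + Real.logb 2 (Real.logb 2 n) := by
  have hn1 : 1 ≤ Real.logb 2 n := by
    rw [Real.le_logb_iff_rpow_le one_lt_two (by linarith)]; simpa using hn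
  have h1 : (k : ℝ) ≤ Real.logb 2 c + Real.logb 2 n := by
    rw [← Real.logb_mul hc.ne' (by linarith),
      Real.le_logb_iff_rpow_le one_lt_two (by positivity), Real.rpow_natCast]
    exact hk.trans (div_le_self (by positivity) hℓ)
  rw [← Real.logb_mul (by positivity) (by linarith)]
  apply Real.logb_le_logb_of_le one_lt_two (by positivity)
  have h2 := le_abs_self (Real.logb 2 c)
  have h3 := abs_nonneg (Real.logb 2 c)
  nlinarith

theorem winnerDeterminationInSpace_mono {r : VotingRule} {c₁ c₂ : ℝ} {B B' : ℕ → ℕ → ℝ → ℝ → ℝ}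
    (h : WinnerDeterminationInSpace r c₁ c₂ B)
    (hB : ∀ m n ε δ, 1 ≤ m → 2 ≤ n → 0 < ε → 0 < δ → δ < 1 →
      0 ≤ B m n ε δ ∧ B m n ε δ ≤ B' m n ε δ) : WinnerDeterminationInSpace r c₁ c₂ B' := by
  intro δ₀ hδ₀
  obtain ⟨K, hK⟩ := h δ₀ hδ₀
  refine ⟨max K 0, fun m n hm hn ε δ hε hδ hδ' => ?_⟩
  obtain ⟨s, A, hs, hA⟩ := hK m n hm hn ε δ hε hδ hδ'
  obtain ⟨h0, h1⟩ := hB m n ε δ hm hn hε hδ (by linarith)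
  refine ⟨s, A, hs.trans ?_, hA⟩
  calc K * B m n ε δ ≤ max K 0 * B m n ε δ := by gcongr; exact le_max_left _ _
    _ ≤ max K 0 * B' m n ε δ := by gcongr

theorem logb_logb_nonneg {n : ℕ} (hn : 2 ≤ n) : 0 ≤ Real.logb 2 (Real.logb 2 n) := by
  apply Real.logb_nonneg one_lt_two
  rw [Real.le_logb_iff_rpow_le one_lt_two (by positivity)]
  simpa using (Nat.cast_le (α := ℝ)).2 hn

/-- The main step: with `ℓ` votes to be sampled, `O(ℓ m log m + log log n)` bits suffice. -/
theorem exists_alg_of_sample_size {r : VotingRule} (hr : HasRobustWinners r)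
    (hne : ∀ (m N : ℕ) (v : Profile m N), 0 < m → (r m N v).Nonempty)
    {c₁ c₂ : ℝ} (hc₁ : 0 < c₁) (hc : c₁ ≤ c₂) {m n : ℕ} (hm : 2 ≤ m) (hn : 2 ≤ n) {ε δ ℓ : ℝ}
    (hε : 0 < ε) (hε1 : ε ≤ 1) (hδ : 0 < δ) (hδ1 : δ < 1) (hℓ : 1 ≤ ℓ)
    (h : 4 * Real.logb 2 m + Real.logb 2 (1 / δ) ≤ (ε / 128) ^ 2 * ℓ / 4) :
    ∃ (s : ℕ) (A : StreamAlg (Vote m) (Fin m) s),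
      (s : ℝ) ≤ 2 + (Real.logb 2 (|Real.logb 2 c₁| + 2) + Real.logb 2 (Real.logb 2 n))
        + (4 * (c₂ / c₁) + 1) * ℓ * (m * Real.logb 2 m) ∧
      SolvesWinnerDetermination r A (c₁ * n) (c₂ * n) ε δ := by
  have hc₂ : 0 < c₂ := hc₁.trans_le hc
  have hn2 : (2 : ℝ) ≤ n := by exact_mod_cast hn
  have hm2 : (2 : ℝ) ≤ m := by exact_mod_cast hm
  have hlm : 0 ≤ Real.logb 2 m := Real.logb_nonneg one_lt_two (by linarith)
  have hlδ : 0 ≤ Real.logb 2 (1 / δ) :=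
    Real.logb_nonneg one_lt_two (by rw [le_div_iff₀ hδ]; linarith)
  -- With `2ᵏ ≤ c₁ n / ℓ < 2ᵏ⁺¹` the expected sample size lies between `ℓ` and `2 (c₂ / c₁) ℓ`;
  -- another factor 2 allows for fluctuation. If `c₁ n < ℓ`, the whole stream fits.
  set L : ℕ := ⌈4 * (c₂ / c₁) * ℓ⌉₊ with hL
  have hLlo : 4 * (c₂ / c₁) * ℓ ≤ L := Nat.le_ceil _
  have hLhi : (L : ℝ) ≤ (4 * (c₂ / c₁) + 1) * ℓ := by
    have := (Nat.ceil_lt_add_one (show 0 ≤ 4 * (c₂ / c₁) * ℓ by positivity)).le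
    linarith
  have hspace : (L : ℝ) * (m * Real.logb 2 m)
      ≤ (4 * (c₂ / c₁) + 1) * ℓ * (m * Real.logb 2 m) := by gcongr
  rcases le_or_gt 1 (c₁ * n / ℓ) with h1 | h1
  · obtain ⟨k, hk1, hk2⟩ := exists_nat_pow_near h1 one_lt_two
    obtain ⟨s, hs, hcard⟩ := exists_space hm k L
    obtain ⟨enc, dec, hd⟩ := StreamAlg.exists_encoding k L hcard
    obtain ⟨out, hout⟩ := exists_out_of_hasRobustWinners hr hm hε hε1
    refine ⟨s, StreamAlg.sampler k L enc dec out, ?_, ?_⟩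
    · have := logb_add_one_le hc₁ hn2 hℓ hk1
      linarith
    · intro N hN1 hN2 v
      have hp : (0 : ℝ) < (1 / 2) ^ k := by positivity
      have hpk : (1 / 2 : ℝ) ^ k * 2 ^ k = 1 := by rw [← mul_pow]; norm_num
      rw [le_div_iff₀ (by positivity)] at hk1
      rw [div_lt_iff₀ (by positivity)] at hk2
      have hlo : ℓ ≤ (1 / 2) ^ k * (c₁ * n) := by
        have := mul_le_mul_of_nonneg_left hk1 hp.le
        rwa [← mul_assoc, hpk, one_mul] at this
      have hhi : (1 / 2) ^ k * (c₁ * n) ≤ 2 * ℓ := by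
        have := mul_le_mul_of_nonneg_left hk2.le hp.le
        have e : (1 / 2 : ℝ) ^ k * (2 ^ (k + 1) * ℓ) = (1 / 2) ^ k * 2 ^ k * (2 * ℓ) := by ring
        rwa [e, hpk, one_mul] at this
      have hlo' : ℓ ≤ (1 / 2) ^ k * N := hlo.trans (by gcongr)
      refine hout k s L enc dec δ hδ1 hd N ?_ ?_ v
      · refine le_trans ?_ hLlo
        calc 2 * ((1 / 2 : ℝ) ^ k * N) ≤ 2 * ((1 / 2) ^ k * (c₂ * n)) := by gcongr
          _ = 2 * (c₂ / c₁) * ((1 / 2) ^ k * (c₁ * n)) := by field_simp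
          _ ≤ 2 * (c₂ / c₁) * (2 * ℓ) := by gcongr
          _ = 4 * (c₂ / c₁) * ℓ := by ring
      · refine four_mul_sq_mul_exp_le hm2 hδ (h.trans ?_) hlδ
        gcongr
  · obtain ⟨s, hs, hcard⟩ := exists_space hm 0 L
    obtain ⟨enc, dec, hd⟩ := StreamAlg.exists_encoding 0 L hcard
    obtain ⟨out, hout⟩ := exists_out_of_nonempty (fun N v => hne m N v (by omega)) hε
    refine ⟨s, StreamAlg.sampler 0 L enc dec out, ?_, ?_⟩
    · have h2 : 0 ≤ Real.logb 2 (|Real.logb 2 c₁| + 2) :=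
        Real.logb_nonneg one_lt_two (by have := abs_nonneg (Real.logb 2 c₁); linarith)
      have h3 := logb_logb_nonneg hn
      rw [Nat.cast_zero, zero_add, Real.logb_one] at hs
      linarith
    · intro N hN1 hN2 v
      refine hout s L enc dec δ hδ.le hd N ?_ v
      rw [div_lt_one (by positivity)] at h1
      have h2 : (N : ℝ) ≤ L := by
        refine le_trans ?_ hLlo
        calc (N : ℝ) ≤ c₂ * n := hN2
          _ = c₂ / c₁ * (c₁ * n) := by field_simp
          _ ≤ c₂ / c₁ * ℓ := by gcongr
          _ ≤ 4 * (c₂ / c₁) * ℓ := by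
            have : 0 ≤ c₂ / c₁ * ℓ := by positivity
            linarith
      exact_mod_cast h2

theorem winnerDeterminationInSpace_of_hasRobustWinners {r : VotingRule} (hr : HasRobustWinners r)
    (hne : ∀ (m N : ℕ) (v : Profile m N), 0 < m → (r m N v).Nonempty)
    (hu : ∀ (m N : ℕ) (w : Fin m), ∃ v : Profile m N, w ∈ r m N v)
    {c₁ c₂ : ℝ} (hc₁ : 0 < c₁) (hc : c₁ ≤ c₂) :
    WinnerDeterminationInSpace r c₁ c₂ fun m n ε δ =>
      (m : ℝ) * Real.logb 2 m ^ 2 * Real.logb 2 (1 / δ) / ε ^ 2 + Real.logb 2 (Real.logb 2 n) := by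
  intro δ₀ hδ₀
  rcases le_or_gt δ₀ 0 with h0 | h0
  · exact ⟨0, fun m n _ _ ε δ _ hδ hδ' => absurd (hδ.trans_le hδ') (not_lt.2 h0)⟩
  have hc₂ : 0 < c₂ := hc₁.trans_le hc
  -- A positive lower bound for `log (1/δ)`, by which additive constants are absorbed into the main
  -- term.
  set a := Real.logb 2 (1 / δ₀) with ha
  have ha0 : 0 < a := Real.logb_pos one_lt_two (by rw [lt_div_iff₀ h0]; linarith)
  -- `65536 = 4 · 128²` cancels the constants of the Chernoff exponent; `4/a + 1` bounds the sum `4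
  -- log m + log (1/δ)` by a product.
  set C : ℝ := 65536 * (4 / a + 1) with hC
  have hC0 : 0 < C := by positivity
  set b := Real.logb 2 (|Real.logb 2 c₁| + 2) with hb
  have hb0 : 0 ≤ b :=
    Real.logb_nonneg one_lt_two (by have := abs_nonneg (Real.logb 2 c₁); linarith)
  have hD : 0 < 4 * (c₂ / c₁) + 1 := by positivity
  refine ⟨1 + (2 + b) / a + (4 * (c₂ / c₁) + 1) * C, fun m n hm hn ε δ hε hδ hδ' => ?_⟩
  have hδ1 : δ < 1 := hδ'.trans_lt hδ₀
  have hll := logb_logb_nonneg hn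
  have hlδ : a ≤ Real.logb 2 (1 / δ) := by
    apply Real.logb_le_logb_of_le one_lt_two (by positivity)
    exact one_div_le_one_div_of_le hδ hδ'
  have hlδ0 : 0 < Real.logb 2 (1 / δ) := ha0.trans_le hlδ
  have hB : 0 ≤ (m : ℝ) * Real.logb 2 m ^ 2 * Real.logb 2 (1 / δ) / ε ^ 2 := by positivity
  -- zero bits suffice if every candidate is an `ε`-winner
  have hconst : ∀ w : Fin m, (∀ N (v : Profile m N), IsEpsWinner r ε v w) →
      ∃ (s : ℕ) (A : StreamAlg (Vote m) (Fin m) s),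
        (s : ℝ) ≤ (1 + (2 + b) / a + (4 * (c₂ / c₁) + 1) * C)
          * ((m : ℝ) * Real.logb 2 m ^ 2 * Real.logb 2 (1 / δ) / ε ^ 2
            + Real.logb 2 (Real.logb 2 n)) ∧
        SolvesWinnerDetermination r A (c₁ * n) (c₂ * n) ε δ := by
    intro w hw
    refine ⟨0, constAlg _ w, ?_, fun N _ _ v =>
      constAlg_answersWithProb w _ _ (hw N v) (by linarith)⟩
    rw [Nat.cast_zero]
    positivity
  -- For `m = 1` the main term vanishes, and for `n = 2` so does `log log n`: the algorithm must use
  -- no memory at all. For `ε ≥ 1` the bound can be arbitrarily small.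
  rcases (show m = 1 ∨ 2 ≤ m by omega) with rfl | hm2
  · refine hconst 0 fun N v => ⟨v, by simp; positivity, ?_⟩
    obtain ⟨w, hw⟩ := hne 1 N v one_pos
    rwa [Subsingleton.elim w 0] at hw
  rcases le_or_gt 1 ε with hε1 | hε1
  · refine hconst ⟨0, hm⟩ fun N v => ?_
    obtain ⟨v', hv'⟩ := hu m N ⟨0, hm⟩
    refine ⟨v', ?_, hv'⟩
    have h1 : (hammingDist v v' : ℝ) ≤ N := by
      have := hammingDist_le_card_fintype (x := v) (y := v')
      rw [Fintype.card_fin] at this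
      exact_mod_cast this
    exact h1.trans (le_mul_of_one_le_left (Nat.cast_nonneg N) hε1)
  have hm2' : (2 : ℝ) ≤ m := by exact_mod_cast hm2
  have hlm : 1 ≤ Real.logb 2 m := by
    rw [Real.le_logb_iff_rpow_le one_lt_two (by linarith)]; simpa using hm2'
  have hε2 : ε ^ 2 ≤ 1 := pow_le_one₀ hε.le hε1.le
  set ℓ : ℝ := C * Real.logb 2 m * Real.logb 2 (1 / δ) / ε ^ 2 with hℓ
  have hprod : a ≤ Real.logb 2 m * Real.logb 2 (1 / δ) := by nlinarith
  have hℓ1 : 1 ≤ ℓ := by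
    rw [hℓ, le_div_iff₀ (by positivity), one_mul]
    have h1 : C * a ≤ C * (Real.logb 2 m * Real.logb 2 (1 / δ)) := by gcongr
    have h2 : C * a = 65536 * (4 + a) := by rw [hC]; field_simp
    linarith
  have hexp : 4 * Real.logb 2 m + Real.logb 2 (1 / δ) ≤ (ε / 128) ^ 2 * ℓ / 4 := by
    have e : (ε / 128) ^ 2 * ℓ / 4 = (4 / a + 1) * Real.logb 2 m * Real.logb 2 (1 / δ) := by
      rw [hℓ, hC]; field_simp; ring
    rw [e]
    have h1 : 4 * Real.logb 2 m ≤ 4 / a * Real.logb 2 m * Real.logb 2 (1 / δ) := by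
      calc 4 * Real.logb 2 m = 4 / a * Real.logb 2 m * a := by field_simp
        _ ≤ _ := by gcongr
    have h2 : Real.logb 2 (1 / δ) ≤ Real.logb 2 m * Real.logb 2 (1 / δ) :=
      le_mul_of_one_le_left hlδ0.le hlm
    linarith
  obtain ⟨s, A, hs, hA⟩ := exists_alg_of_sample_size hr hne hc₁ hc hm2 hn hε hε1.le hδ hδ1 hℓ1 hexp
  refine ⟨s, A, hs.trans ?_, hA⟩
  set X := (m : ℝ) * Real.logb 2 m ^ 2 * Real.logb 2 (1 / δ) / ε ^ 2 with hX
  have e1 : ℓ * (m * Real.logb 2 m) = C * X := by rw [hℓ, hX]; ring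
  have hXa : a ≤ X := by
    rw [hX, le_div_iff₀ (by positivity)]
    calc a * ε ^ 2 ≤ a * 1 := by gcongr
      _ = 1 * 1 ^ 2 * a := by ring
      _ ≤ m * Real.logb 2 m ^ 2 * Real.logb 2 (1 / δ) := by gcongr; linarith
  have h1 : 2 + b ≤ (2 + b) / a * X := by
    calc 2 + b = (2 + b) / a * a := by field_simp
      _ ≤ _ := by gcongr
  have h2 : 0 ≤ ((2 + b) / a + (4 * (c₂ / c₁) + 1) * C) * Real.logb 2 (Real.logb 2 n) := by
    positivity
  rw [mul_assoc (4 * (c₂ / c₁) + 1) ℓ, e1]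
  have h3 : 0 ≤ X := hB
  nlinarith

/-! ### The four rules -/

theorem mainTheorem10 (c₁ c₂ : ℝ) (hc₁ : 0 < c₁) (hc : c₁ ≤ c₂) :
    (∀ r : VotingRule, r = maximinRule ∨ r = bucklinRule ∨ r = runoffRule →
      WinnerDeterminationInSpace r c₁ c₂ fun m n ε δ =>
        (m : ℝ) * Real.logb 2 m ^ 2 * Real.logb 2 (1 / δ) / ε ^ 2
          + Real.logb 2 (Real.logb 2 n)) ∧
    WinnerDeterminationInSpace copelandRule c₁ c₂ fun m n ε δ =>
      (m : ℝ) * Real.logb 2 m ^ 4 * Real.logb 2 (1 / δ) / ε ^ 2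
        + Real.logb 2 (Real.logb 2 n) := by
  constructor
  · rintro r (rfl | rfl | rfl)
    · exact winnerDeterminationInSpace_of_hasRobustWinners maximinRule_hasRobustWinners
        (fun _ _ v hm => maximinRule_nonempty hm v)
        (fun _ _ w => ⟨_, mem_maximinRule_unanimous w⟩) hc₁ hc
    · exact winnerDeterminationInSpace_of_hasRobustWinners bucklinRule_hasRobustWinners
        (fun _ _ v hm => bucklinRule_nonempty hm v)
        (fun _ _ w => ⟨_, mem_bucklinRule_unanimous w⟩) hc₁ hc
    · exact winnerDeterminationInSpace_of_hasRobustWinners runoffRule_hasRobustWinners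
        (fun _ _ v hm => runoffRule_nonempty hm v)
        (fun _ _ w => ⟨_, mem_runoffRule_unanimous w⟩) hc₁ hc
  -- Copeland satisfies the bound with `log² m` as well; `log⁴ m` is no smaller, since `log m` is 0
  -- or at least 1.
  · refine winnerDeterminationInSpace_mono
      (winnerDeterminationInSpace_of_hasRobustWinners copelandRule_hasRobustWinners
        (fun _ _ v hm => copelandRule_nonempty hm v)
        (fun _ _ w => ⟨_, mem_copelandRule_unanimous w⟩) hc₁ hc) ?_
    intro m n ε δ hm hn hε hδ hδ1
    have hlδ : 0 ≤ Real.logb 2 (1 / δ) :=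
      Real.logb_nonneg one_lt_two (by rw [le_div_iff₀ hδ]; linarith)
    have hll := logb_logb_nonneg hn
    refine ⟨by positivity, ?_⟩
    have : Real.logb 2 m ^ 2 ≤ Real.logb 2 m ^ 4 := by
      rcases (show m = 1 ∨ 2 ≤ m by omega) with rfl | hm2
      · simp
      · apply pow_le_pow_right₀ _ (by norm_num)
        rw [Real.le_logb_iff_rpow_le one_lt_two (by positivity)]
        simpa using (Nat.cast_le (α := ℝ)).2 hm2
    gcongr
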